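/- **Setting.** Let $d\ge 1$. A *tile* is a bounded Lebesgue measurable set $T\subset\mathbb R^d$ of positive measure with $\mathrm{vol}(\partial T)=0$. A *tessellation* of a set $U$ is a collection of tiles with pairwise disjoint interiors and with union $U$; it is a *patch* if $U$ is bounded and a *tiling* if $U=\mathbb R^d$. A (normalized) *multiscale substitution scheme* $\sigma$ in $\mathbb R^d$ consists of finitely many prototiles $T_1,\dots,T_n$ of volume $1$ and, for each $i$, a tessellation $\varrho_\sigma(T_i)$ of $T_i$ by finitely many translates of tiles $\alpha T_j$ with $0<\alpha<1$. All tiles below are translates $\alpha T_j+v$ ($\alpha>0$) of rescaled prototiles, and they carry the label (type) $j$. For $t\ge 0$, $F_t(T_i)$ is the patch obtained from the single tile $e^tT_i$ by repeatedly substituting (by the rescaled rule $\varrho_\sigma$) every tile of volume larger than $1$, until all tiles have volume at most $1$; $\operatorname{supp}F_t(T_i)$ is the union of its tiles. The scheme is *irreducible* if for all $i,j$ there is $t>0$ such that $F_t(T_i)$ contains a tile of type $j$. It is *incommensurable* if there are $i,j$ and $t_1,t_2>0$ with $t_1\notin\mathbb Q\,t_2$ such that $F_{t_1}(T_i)$ contains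 a tile of type $i$ of volume $1$ and $F_{t_2}(T_j)$ contains a tile of type $j$ of volume $1$. For $r>0$ put $A^{+r}=\{x\in\mathbb R^d:\mathrm{dist}(x,A)\le r\}$, and let $$D(A,B)=\inf\big(\{r>0: A\cap B(0,1/r)\subset B^{+r},\ B\cap B(0,1/r)\subset A^{+r}\}\cup\{1\}\big)$$ be the Chabauty–Fell metric on closed subsets of $\mathbb R^d$. The *tiling space* $\mathbb X_\sigma^F$ is the set of all tilings $\mathcal T$ of $\mathbb R^d$ by (labelled) translates of rescaled prototiles such that every finite sub-patch $\mathcal Q$ of $\mathcal T$ is a limit of translated sub-patches of patches $F_t(T_i)$. That is, there are $t_k\ge0$, indices $i_k$, vectors $v_k\in\mathbb R^d$, and label-preserving bijections $\phi_k$ from $\mathcal Q$ onto sub-patches of $F_{t_k}(T_{i_k})$ such that $D\big(\partial(\phi_k(Q)+v_k),\partial Q\big)\to0$ as $k\to\infty$ for every tile $Q\in\mathcal Q$. A point set $Y\subset\mathbb R^d$ is *uniformly spread* if there are $\alpha>0$ and a bijection $\phi:Y\to\alpha\mathbb Z^d$ with $\sup_{y\in Y}\|y-\phi(y)\|<\infty$.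 A tiling $\mathcal T$ is *uniformly spread* if there is a uniformly spread point set obtained by picking one point from each tile of $\mathcal T$, with distinct points for distinct tiles. **Theorem.** Let $\sigma$ be an irreducible incommensurable multiscale substitution scheme in $\mathbb R^d$, and assume that for some $\eta>0$ every prototile $T_i$ satisfies $$\mathrm{vol}\big((\partial\operatorname{supp}F_t(T_i))^{+1}\big)=O\big(e^{(d-\eta)t}\big)\qquad(t\to\infty).$$ Then no tiling $\mathcal T\in\mathbb X_\sigma^F$ is uniformly spread. -/

import Mathlib

open Filter Topology MeasureTheory
open scoped Asymptotics

noncomputable section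

namespace Multiscale

/-- Euclidean space `ℝ^d`. -/
abbrev Space (d : ℕ) : Type := EuclideanSpace ℝ (Fin d)

/-- A tile: a bounded Lebesgue measurable set of positive measure whose boundary is null. -/
structure IsTile {d : ℕ} (T : Set (Space d)) : Prop where
  bounded : Bornology.IsBounded T
  measurable : NullMeasurableSet T volume
  volume_pos : 0 < volume T
  boundary_null : volume (frontier T) = 0

/-- A labelled tile: given a list of prototiles `T`, it stands for the translated rescaled copy
`scale • T label + pos` of the prototile `T label`, remembered together with its type `label`. -/
@[ext] structure PlacedTile (d n : ℕ) where
  label : Fin n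
  scale : ℝ
  pos : Space d

namespace PlacedTile

variable {d n : ℕ}

/-- The subset of `ℝ^d` occupied by a labelled tile. -/
def support (T : Fin n → Set (Space d)) (τ : PlacedTile d n) : Set (Space d) :=
  (fun x => τ.scale • x + τ.pos) '' T τ.label

/-- The translate of a labelled tile by a vector. -/
def translate (τ : PlacedTile d n) (v : Space d) : PlacedTile d n :=
  ⟨τ.label, τ.scale, τ.pos + v⟩

/-- The image of the labelled tile `ρ` under the similarity `x ↦ τ.scale • x + τ.pos` that carries
the prototile of the type of `τ` onto the tile `τ`. -/
def place (τ ρ : PlacedTile d n) : PlacedTile d n :=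
  ⟨ρ.label, τ.scale * ρ.scale, τ.scale • ρ.pos + τ.pos⟩

end PlacedTile

/-- `P` is a tessellation of `U` by translated rescaled copies of the prototiles `T`:
the tiles have pairwise disjoint interiors and their union is `U`. -/
structure IsTessellation {d n : ℕ} (T : Fin n → Set (Space d)) (P : Set (PlacedTile d n))
    (U : Set (Space d)) : Prop where
  scale_pos : ∀ τ ∈ P, 0 < τ.scale
  disjoint_interior :
    P.Pairwise fun τ ρ => Disjoint (interior (τ.support T)) (interior (ρ.support T))
  cover : ⋃ τ ∈ P, τ.support T = U

/-- A (normalized) multiscale substitution scheme in `ℝ^d` with `n` prototiles of unit volume.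
`rule i` is the tessellation of the prototile of type `i` prescribed by the substitution rule. The
scales are smaller than one, that is, the edges of the associated graph, of length `log (1 / α)`,
have positive length. -/
structure SubstitutionScheme (d n : ℕ) where
  prototile : Fin n → Set (Space d)
  rule : Fin n → Finset (PlacedTile d n)
  isTile : ∀ i, IsTile (prototile i)
  normalized : ∀ i, volume (prototile i) = 1
  tessellation : ∀ i, IsTessellation prototile (rule i : Set (PlacedTile d n)) (prototile i)
  scale_lt_one : ∀ i, ∀ ρ ∈ rule i, ρ.scale < 1

namespace SubstitutionScheme

variable {d n : ℕ} (σ : SubstitutionScheme d n)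

/-- The subset of `ℝ^d` occupied by a labelled tile. -/
def tileSet (τ : PlacedTile d n) : Set (Space d) := τ.support σ.prototile

/-- The tiles that arise from `τ₀` by repeatedly substituting tiles of volume larger than one. -/
inductive Descendant (τ₀ : PlacedTile d n) : PlacedTile d n → Prop
  | refl : Descendant τ₀ τ₀
  | step (τ ρ : PlacedTile d n) : Descendant τ₀ τ → 1 < volume (σ.tileSet τ) →
      ρ ∈ σ.rule τ.label → Descendant τ₀ (τ.place ρ)

/-- The substitution semi-flow: the patch `F_t(T_i)` is obtained from the single tile `e^t T_i` by
substituting tiles of volume larger than one until all tiles have volume at most one. -/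
def flow (t : ℝ) (i : Fin n) : Set (PlacedTile d n) :=
  {τ | σ.Descendant ⟨i, Real.exp t, 0⟩ τ ∧ volume (σ.tileSet τ) ≤ 1}

/-- The support of the patch `F_t(T_i)`. -/
def flowSupport (t : ℝ) (i : Fin n) : Set (Space d) := ⋃ τ ∈ σ.flow t i, σ.tileSet τ

/-- For all `i, j` some patch `F_t(T_i)` with `t > 0` contains a tile of type `j`. -/
def Irreducible : Prop :=
  ∀ i j : Fin n, ∃ t : ℝ, 0 < t ∧ ∃ τ ∈ σ.flow t i, τ.label = j

/-- The positive times `t` at which `F_t(T_i)` contains a tile of type `i` of unit volume, that is,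
the lengths of the nontrivial closed paths through `i` in the associated graph. -/
def returnTimes (i : Fin n) : Set ℝ :=
  {t | 0 < t ∧ ∃ τ ∈ σ.flow t i, τ.label = i ∧ volume (σ.tileSet τ) = 1}

/-- There are two return times, possibly of different prototiles, with irrational ratio. -/
def Incommensurable : Prop :=
  ∃ i j : Fin n, ∃ t₁ ∈ σ.returnTimes i, ∃ t₂ ∈ σ.returnTimes j, ∀ q : ℚ, t₁ ≠ (q : ℝ) * t₂

end SubstitutionScheme

/-- The metric of the Chabauty--Fell topology on closed subsets of `ℝ^d`. -/
def chabautyFellDist {d : ℕ} (A B : Set (Space d)) : ℝ :=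
  sInf ({r : ℝ | 0 < r ∧ A ∩ Metric.ball 0 (1 / r) ⊆ Metric.cthickening r B ∧
    B ∩ Metric.ball 0 (1 / r) ⊆ Metric.cthickening r A} ∪ {1})

namespace SubstitutionScheme

variable {d n : ℕ} (σ : SubstitutionScheme d n)

/-- The finite labelled patch `Q` is a limit of translated sub-patches of the generating patches
`F_t(T_i)`, `t ≥ 0`: the tiles of `Q` correspond bijectively, with matching labels, to the tiles of
the sub-patches `φ k '' Q`, and the boundaries of the corresponding tiles converge in the
Chabauty--Fell metric. -/
def IsLimitOfSubpatches (Q : Finset (PlacedTile d n)) : Prop :=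
  ∃ (t : ℕ → ℝ) (i : ℕ → Fin n) (v : ℕ → Space d) (φ : ℕ → PlacedTile d n → PlacedTile d n),
    (∀ k, 0 ≤ t k ∧ Set.InjOn (φ k) (Q : Set (PlacedTile d n)) ∧
      ∀ τ ∈ Q, φ k τ ∈ σ.flow (t k) (i k) ∧ (φ k τ).label = τ.label) ∧
    ∀ τ ∈ Q, Tendsto (fun k => chabautyFellDist
      (frontier (σ.tileSet ((φ k τ).translate (v k)))) (frontier (σ.tileSet τ))) atTop (𝓝 0)

/-- The multiscale tiling space: the tilings of `ℝ^d` all of whose finite sub-patches are limits of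
translated sub-patches of generating patches. -/
def tilingSpace : Set (Set (PlacedTile d n)) :=
  {𝒯 | IsTessellation σ.prototile 𝒯 Set.univ ∧
    ∀ Q : Finset (PlacedTile d n), (Q : Set (PlacedTile d n)) ⊆ 𝒯 → σ.IsLimitOfSubpatches Q}

end SubstitutionScheme

/-- The lattice `α ℤ^d`. -/
def scaledIntegerLattice (d : ℕ) (α : ℝ) : Set (Space d) :=
  {x | ∃ z : Fin d → ℤ, ∀ m, x m = α * z m}

/-- A point set is uniformly spread if a bijection at bounded distance from the identity maps it
onto `α ℤ^d` for some `α > 0`. -/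
def PointSetUniformlySpread {d : ℕ} (Y : Set (Space d)) : Prop :=
  ∃ α : ℝ, 0 < α ∧ ∃ φ : Space d → Space d, Set.BijOn φ Y (scaledIntegerLattice d α) ∧
    ∃ C : ℝ, ∀ y ∈ Y, ‖y - φ y‖ ≤ C

/-- A tiling is uniformly spread if picking a point from each tile, distinct points for distinct
tiles, one can obtain a uniformly spread point set. -/
def SubstitutionScheme.UniformlySpread {d n : ℕ} (σ : SubstitutionScheme d n)
    (𝒯 : Set (PlacedTile d n)) : Prop :=
  ∃ y : PlacedTile d n → Space d, Set.InjOn y 𝒯 ∧ (∀ τ ∈ 𝒯, y τ ∈ σ.tileSet τ) ∧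
    PointSetUniformlySpread (y '' 𝒯)

end Multiscale

end

/-! Suppose a tiling is uniformly spread along `α ℤ^d`, and let N(s) be the number of tiles of
F_s(T_j), whose support e^s T_j has volume e^{ds}. Wherever this patch occurs in the tiling up to
bounded displacement, its tiles are matched with lattice points a bounded distance away. Comparing
cubes with volume (`lattice_count_vs_volume`) shows that α^d N(s) differs from e^{ds} by at most the
volume of a neighbourhood of the boundary, which is O(e^{(d-η)s}) by hypothesis.

Incommensurability makes path lengths asymptotically dense (`exists_path_length_mem`). Hence every
interval [s, s + δ) with s > 0 contains a time s' for which a translate of F_{s'}(T_j) sits inside a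
large generating patch that `exists_leaves_matching` compares with the tiling. This gives
`exists_discrepancy_bound`.

On the other hand N changes only at path lengths (`ncard_flow_eq`). A length depends only on how
often each of finitely many scales is used, so there are only polynomially many lengths up to m + 1
(`exists_finset_path_lengths`). Some subinterval of [m, m + 1] of length at least 1/poly(m) is
therefore free of jumps. By density it contains two good times that are a third of its length apart;
N agrees there, while e^{ds} grows by at least e^{dm}/poly(m), too much for the error term
(`not_exponential_of_few_jumps`). -/

namespace Multiscale

variable {d n : ℕ}

/-! ### Similarities acting on labelled tiles -/

namespace PlacedTile

/-- The similarity `x ↦ τ.scale • x + τ.pos` as a homeomorphism, for a tile of nonzero scale. -/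
noncomputable def similarity (τ : PlacedTile d n) (h : τ.scale ≠ 0) : Space d ≃ₜ Space d :=
  (Homeomorph.smulOfNeZero τ.scale h).trans (Homeomorph.addRight τ.pos)

lemma similarity_apply (τ : PlacedTile d n) (h : τ.scale ≠ 0) (x : Space d) :
    τ.similarity h x = τ.scale • x + τ.pos := rfl

lemma support_eq_similarity (T : Fin n → Set (Space d)) (τ : PlacedTile d n) (h : τ.scale ≠ 0) :
    τ.support T = τ.similarity h '' T τ.label := rfl

lemma support_place (T : Fin n → Set (Space d)) (κ τ : PlacedTile d n) (h : κ.scale ≠ 0) :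
    (κ.place τ).support T = κ.similarity h '' τ.support T := by
  simp only [support, place, Set.image_image, similarity_apply]
  refine Set.image_congr fun x _ => ?_
  simp only [smul_add, mul_smul, add_assoc]

lemma place_assoc (κ τ ρ : PlacedTile d n) : (κ.place τ).place ρ = κ.place (τ.place ρ) := by
  ext1
  · rfl
  · simp [place, mul_assoc]
  · simp [place, smul_add, mul_smul, add_assoc]

lemma place_injective (κ : PlacedTile d n) (h : κ.scale ≠ 0) : Function.Injective κ.place := by
  rintro ⟨l, a, p⟩ ⟨l', a', p'⟩ he
  simp only [place, PlacedTile.mk.injEq] at he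
  obtain ⟨h1, h2, h3⟩ := he
  rw [add_left_inj] at h3
  rw [mul_right_inj' h] at h2
  rw [h1, h2, smul_right_injective _ h h3]

lemma frontier_support (T : Fin n → Set (Space d)) (τ : PlacedTile d n) (h : τ.scale ≠ 0) :
    frontier (τ.support T) = (fun x => τ.scale • x + τ.pos) '' frontier (T τ.label) :=
  ((τ.similarity h).image_frontier (T τ.label)).symm

open scoped Pointwise in
lemma volume_image (τ : PlacedTile d n) (h : 0 ≤ τ.scale) (A : Set (Space d)) :
    volume ((fun x => τ.scale • x + τ.pos) '' A) = ENNReal.ofReal (τ.scale ^ d) * volume A := by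
  have h1 : (fun x => τ.scale • x + τ.pos) '' A = (fun x => x + (-τ.pos)) ⁻¹' (τ.scale • A) := by
    ext x
    simp only [Set.mem_image, Set.mem_preimage, Set.mem_smul_set]
    constructor
    · rintro ⟨y, hy, rfl⟩
      exact ⟨y, hy, by simp⟩
    · rintro ⟨y, hy, hxy⟩
      exact ⟨y, hy, by rw [hxy]; simp⟩
  rw [h1, measure_preimage_add_right, Measure.addHaar_smul, finrank_euclideanSpace_fin,
    abs_of_nonneg (pow_nonneg h d)]

end PlacedTile

/-! ### Volumes and scales of tiles -/

namespace SubstitutionScheme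

variable (σ : SubstitutionScheme d n)

lemma volume_tileSet (τ : PlacedTile d n) (h : 0 ≤ τ.scale) :
    volume (σ.tileSet τ) = ENNReal.ofReal (τ.scale ^ d) := by
  rw [tileSet, PlacedTile.support, PlacedTile.volume_image τ h, σ.normalized, mul_one]

lemma volume_frontier_tileSet (τ : PlacedTile d n) (h : 0 < τ.scale) :
    volume (frontier (σ.tileSet τ)) = 0 := by
  rw [tileSet, PlacedTile.frontier_support _ _ h.ne', PlacedTile.volume_image τ h.le,
    (σ.isTile _).boundary_null, mul_zero]

/-- Since boundaries are null, tiles with disjoint interiors can be treated as disjoint in volume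
counts. -/
lemma volume_interior_tileSet (τ : PlacedTile d n) (h : 0 < τ.scale) :
    volume (interior (σ.tileSet τ)) = volume (σ.tileSet τ) :=
  le_antisymm (measure_mono interior_subset) <| by
    calc volume (σ.tileSet τ) ≤ volume (interior (σ.tileSet τ) ∪ frontier (σ.tileSet τ)) := by
          refine measure_mono (subset_closure.trans ?_)
          rw [closure_eq_interior_union_frontier]
      _ ≤ _ := (measure_union_le _ _).trans (by rw [σ.volume_frontier_tileSet τ h, add_zero])

variable {σ}

lemma one_lt_volume_tileSet_iff (hd : 0 < d) {τ : PlacedTile d n} (h : 0 < τ.scale) :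
    1 < volume (σ.tileSet τ) ↔ 1 < τ.scale := by
  rw [σ.volume_tileSet τ h.le, ENNReal.one_lt_ofReal, one_lt_pow_iff_of_nonneg h.le hd.ne']

lemma volume_tileSet_le_one_iff (hd : 0 < d) {τ : PlacedTile d n} (h : 0 < τ.scale) :
    volume (σ.tileSet τ) ≤ 1 ↔ τ.scale ≤ 1 := by
  rw [← not_lt, one_lt_volume_tileSet_iff hd h, not_lt]

lemma tileSet_nonempty (τ : PlacedTile d n) : (σ.tileSet τ).Nonempty := by
  refine Set.Nonempty.image _ (nonempty_of_measure_ne_zero (μ := volume) ?_)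
  rw [σ.normalized]; exact one_ne_zero

lemma interior_tileSet_nonempty {τ : PlacedTile d n} (h : 0 < τ.scale) :
    (interior (σ.tileSet τ)).Nonempty := by
  refine nonempty_of_measure_ne_zero (μ := volume) ?_
  rw [σ.volume_interior_tileSet τ h, σ.volume_tileSet τ h.le]
  exact (ENNReal.ofReal_pos.2 (pow_pos h d)).ne'

lemma rule_scale_pos {i : Fin n} {ρ : PlacedTile d n} (hρ : ρ ∈ σ.rule i) : 0 < ρ.scale :=
  (σ.tessellation i).scale_pos ρ hρ

variable (σ)

/-- All the scales that occur in the substitution rule. -/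
noncomputable def scales : Finset ℝ :=
  Finset.univ.biUnion fun i => (σ.rule i).image PlacedTile.scale

variable {σ}

lemma scale_mem_scales {i : Fin n} {ρ : PlacedTile d n} (hρ : ρ ∈ σ.rule i) :
    ρ.scale ∈ σ.scales :=
  Finset.mem_biUnion.2 ⟨i, Finset.mem_univ i, Finset.mem_image_of_mem _ hρ⟩

lemma mem_scales_bounds {x : ℝ} (hx : x ∈ σ.scales) : 0 < x ∧ x < 1 := by
  obtain ⟨i, -, hi⟩ := Finset.mem_biUnion.1 hx
  obtain ⟨ρ, hρ, rfl⟩ := Finset.mem_image.1 hi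
  exact ⟨rule_scale_pos hρ, σ.scale_lt_one i ρ hρ⟩

lemma _root_.Finset.exists_upper_lt_one (S : Finset ℝ) (h : ∀ x ∈ S, x < 1) :
    ∃ β : ℝ, 0 < β ∧ β < 1 ∧ ∀ x ∈ S, x ≤ β := by
  induction S using Finset.induction_on with
  | empty => exact ⟨1 / 2, by norm_num, by norm_num, by simp⟩
  | insert a S _ ih =>
    obtain ⟨β, h0, h1, hβ⟩ := ih fun x hx => h x (Finset.mem_insert_of_mem hx)
    refine ⟨max a β, lt_max_of_lt_right h0, max_lt (h a (Finset.mem_insert_self a S)) h1, ?_⟩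
    intro x hx
    rcases Finset.mem_insert.1 hx with rfl | hx
    · exact le_max_left _ _
    · exact (hβ x hx).trans (le_max_right _ _)

lemma _root_.Finset.exists_lower_pos (S : Finset ℝ) (h : ∀ x ∈ S, 0 < x) :
    ∃ β : ℝ, 0 < β ∧ β < 1 ∧ ∀ x ∈ S, β ≤ x := by
  induction S using Finset.induction_on with
  | empty => exact ⟨1 / 2, by norm_num, by norm_num, by simp⟩
  | insert a S _ ih =>
    obtain ⟨β, h0, h1, hβ⟩ := ih fun x hx => h x (Finset.mem_insert_of_mem hx)
    refine ⟨min a β, lt_min (h a (Finset.mem_insert_self a S)) h0, min_lt_of_right_lt h1, ?_⟩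
    intro x hx
    rcases Finset.mem_insert.1 hx with rfl | hx
    · exact min_le_left _ _
    · exact (min_le_right _ _).trans (hβ x hx)

variable (σ)

lemma exists_scale_upper : ∃ β : ℝ, 0 < β ∧ β < 1 ∧ ∀ i, ∀ ρ ∈ σ.rule i, ρ.scale ≤ β := by
  obtain ⟨β, h0, h1, h⟩ := σ.scales.exists_upper_lt_one fun x hx => (mem_scales_bounds hx).2
  exact ⟨β, h0, h1, fun i ρ hρ => h _ (scale_mem_scales hρ)⟩

lemma exists_scale_lower : ∃ β : ℝ, 0 < β ∧ β < 1 ∧ ∀ i, ∀ ρ ∈ σ.rule i, β ≤ ρ.scale := by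
  obtain ⟨β, h0, h1, h⟩ := σ.scales.exists_lower_pos fun x hx => (mem_scales_bounds hx).1
  exact ⟨β, h0, h1, fun i ρ hρ => h _ (scale_mem_scales hρ)⟩

lemma exists_prototile_norm_le : ∃ D : ℝ, 0 < D ∧ ∀ i, ∀ x ∈ σ.prototile i, ‖x‖ ≤ D := by
  have h : ∀ i, ∃ D : ℝ, ∀ x ∈ σ.prototile i, ‖x‖ ≤ D := fun i =>
    (σ.isTile i).bounded.exists_norm_le
  choose D hD using h
  refine ⟨1 + ∑ i, |D i|, by positivity, fun i x hx => (hD i x hx).trans ?_⟩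
  have := Finset.single_le_sum (f := fun i => |D i|) (fun i _ => abs_nonneg _) (Finset.mem_univ i)
  have h2 := le_abs_self (D i)
  linarith

/-! ### Descendants and leaves of a tile -/

/-- The tiles of volume at most one obtained by substituting `τ₀`. -/
def leaves (τ₀ : PlacedTile d n) : Set (PlacedTile d n) :=
  {τ | σ.Descendant τ₀ τ ∧ volume (σ.tileSet τ) ≤ 1}

variable {σ}

lemma tileSet_eq_iUnion_rule (τ : PlacedTile d n) (h : τ.scale ≠ 0) :
    σ.tileSet τ = ⋃ ρ ∈ σ.rule τ.label, σ.tileSet (τ.place ρ) := by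
  have h1 := (σ.tessellation τ.label).cover
  rw [tileSet, PlacedTile.support_eq_similarity _ _ h, ← h1, Set.image_iUnion₂]
  refine Set.iUnion₂_congr fun ρ _ => ?_
  rw [tileSet, PlacedTile.support_place _ _ _ h]

lemma tileSet_place_subset {τ ρ : PlacedTile d n} (h : τ.scale ≠ 0) (hρ : ρ ∈ σ.rule τ.label) :
    σ.tileSet (τ.place ρ) ⊆ σ.tileSet τ := by
  rw [tileSet_eq_iUnion_rule τ h]
  exact Set.subset_biUnion_of_mem (u := fun ρ => σ.tileSet (τ.place ρ)) hρ

namespace Descendant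

variable {τ₀ τ : PlacedTile d n}

lemma scale_pos (h : σ.Descendant τ₀ τ) (h0 : 0 < τ₀.scale) : 0 < τ.scale := by
  induction h with
  | refl => exact h0
  | step τ ρ _ _ hρ ih => exact mul_pos ih (rule_scale_pos hρ)

lemma trans {τ₁ : PlacedTile d n} (h1 : σ.Descendant τ₀ τ₁) (h2 : σ.Descendant τ₁ τ) :
    σ.Descendant τ₀ τ := by
  induction h2 with
  | refl => exact h1
  | step τ ρ _ hv hρ ih => exact ih.step _ _ hv hρ

/-- `Descendant` grows at the last substitution; peeling off the first one instead gives the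
recursion for `leaves`. -/
lemma eq_or_head (h : σ.Descendant τ₀ τ) :
    τ = τ₀ ∨ (1 < volume (σ.tileSet τ₀) ∧
      ∃ ρ ∈ σ.rule τ₀.label, σ.Descendant (τ₀.place ρ) τ) := by
  induction h with
  | refl => exact Or.inl rfl
  | step τ ρ _ hv hρ ih =>
    rcases ih with rfl | ⟨h1, ρ', hρ', h2⟩
    · exact Or.inr ⟨hv, ρ, hρ, .refl⟩
    · exact Or.inr ⟨h1, ρ', hρ', h2.step _ _ hv hρ⟩

lemma head {ρ : PlacedTile d n} (hv : 1 < volume (σ.tileSet τ₀)) (hρ : ρ ∈ σ.rule τ₀.label)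
    (h : σ.Descendant (τ₀.place ρ) τ) : σ.Descendant τ₀ τ :=
  (Descendant.step τ₀ ρ .refl hv hρ).trans h

lemma tileSet_subset (h : σ.Descendant τ₀ τ) (h0 : 0 < τ₀.scale) :
    σ.tileSet τ ⊆ σ.tileSet τ₀ := by
  induction h with
  | refl => exact subset_rfl
  | step τ ρ hτ _ hρ ih => exact (tileSet_place_subset (hτ.scale_pos h0).ne' hρ).trans ih

/-- Only tiles of scale above one are substituted, so a child has scale at least `β`. The resulting
lower bound on leaf volumes later leaves no room for an unmatched leaf. -/
lemma le_scale (hd : 0 < d) {β : ℝ} (hβ : β < 1) (hβr : ∀ i, ∀ ρ ∈ σ.rule i, β ≤ ρ.scale)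
    (h : σ.Descendant τ₀ τ) (h0 : 1 ≤ τ₀.scale) : β ≤ τ.scale := by
  cases h with
  | refl => linarith
  | step τ ρ h hv hρ =>
    have h1 := (one_lt_volume_tileSet_iff hd (h.scale_pos (one_pos.trans_le h0))).1 hv
    have h2 := hβr _ ρ hρ
    have h3 := rule_scale_pos hρ
    change β ≤ τ.scale * ρ.scale
    nlinarith

/-- Every descendant smaller than `b` has an ancestor whose scale is comparable to `b`. -/
lemma exists_ancestor {β b : ℝ} (hβr : ∀ i, ∀ ρ ∈ σ.rule i, β ≤ ρ.scale)
    (h : σ.Descendant τ₀ τ) (h0 : 0 < τ₀.scale) (hb : b ≤ τ₀.scale) (hτ : τ.scale < b) :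
    ∃ θ, σ.Descendant τ₀ θ ∧ σ.Descendant θ τ ∧ b ≤ θ.scale ∧ θ.scale * β < b := by
  induction h with
  | refl => linarith
  | step τ ρ hd hv hρ ih =>
    rcases lt_or_ge τ.scale b with h1 | h1
    · obtain ⟨θ, a1, a2, a3⟩ := ih h1
      exact ⟨θ, a1, a2.step _ _ hv hρ, a3⟩
    · refine ⟨τ, hd, .step τ ρ .refl hv hρ, h1, lt_of_le_of_lt ?_ hτ⟩
      exact mul_le_mul_of_nonneg_left (hβr _ ρ hρ) (hd.scale_pos h0).le

end Descendant

/-- Induction along the substitution, from tiles of volume at most one upwards. -/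
lemma substitution_induction {p : PlacedTile d n → Prop}
    (small : ∀ τ, 0 < τ.scale → τ.scale ≤ 1 → p τ)
    (large : ∀ τ, 1 < τ.scale → (∀ ρ ∈ σ.rule τ.label, p (τ.place ρ)) → p τ)
    (τ : PlacedTile d n) (h : 0 < τ.scale) : p τ := by
  obtain ⟨β, h0, h1, hβ⟩ := σ.exists_scale_upper
  -- Each substitution shrinks by a factor of at most `β < 1`, so `m` bounds the remaining depth.
  have key : ∀ m : ℕ, ∀ τ : PlacedTile d n, 0 < τ.scale → τ.scale * β ^ m ≤ 1 → p τ := by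
    intro m
    induction m with
    | zero => intro τ hτ h; exact small τ hτ (by simpa using h)
    | succ m ih =>
      intro τ hτ h
      rcases le_or_gt τ.scale 1 with h2 | h2
      · exact small τ hτ h2
      · refine large τ h2 fun ρ hρ => ih _ (mul_pos hτ (rule_scale_pos hρ)) ?_
        refine le_trans ?_ h
        change τ.scale * ρ.scale * β ^ m ≤ _
        rw [pow_succ', ← mul_assoc]
        gcongr
        exact hβ _ _ hρ
  obtain ⟨m, hm⟩ := exists_pow_lt_of_lt_one (inv_pos.2 h) h1
  refine key m τ h ?_
  calc τ.scale * β ^ m ≤ τ.scale * τ.scale⁻¹ := by gcongr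
    _ = 1 := mul_inv_cancel₀ h.ne'

lemma leaves_of_scale_le_one (hd : 0 < d) {τ : PlacedTile d n} (h : 0 < τ.scale)
    (h1 : τ.scale ≤ 1) : σ.leaves τ = {τ} := by
  have hv := (volume_tileSet_le_one_iff (σ := σ) hd h).2 h1
  ext ρ
  constructor
  · rintro ⟨hρ, -⟩
    rcases hρ.eq_or_head with rfl | ⟨h2, -⟩
    · rfl
    · exact absurd hv (not_le.2 h2)
  · rintro rfl
    exact ⟨.refl, hv⟩

lemma leaves_of_one_lt_scale (hd : 0 < d) {τ : PlacedTile d n} (h : 1 < τ.scale) :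
    σ.leaves τ = ⋃ ρ ∈ σ.rule τ.label, σ.leaves (τ.place ρ) := by
  have hv := (one_lt_volume_tileSet_iff (σ := σ) hd (one_pos.trans h)).2 h
  ext ρ
  simp only [Set.mem_iUnion, exists_prop]
  constructor
  · rintro ⟨hρ, h1⟩
    rcases hρ.eq_or_head with rfl | ⟨-, ρ', hρ', h2⟩
    · exact absurd h1 (not_le.2 hv)
    · exact ⟨ρ', hρ', h2, h1⟩
  · rintro ⟨ρ', hρ', h1, h2⟩
    exact ⟨h1.head hv hρ', h2⟩

lemma iUnion_leaves (hd : 0 < d) (τ₀ : PlacedTile d n) (h : 0 < τ₀.scale) :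
    ⋃ τ ∈ σ.leaves τ₀, σ.tileSet τ = σ.tileSet τ₀ := by
  refine substitution_induction (σ := σ)
    (p := fun τ₀ => ⋃ τ ∈ σ.leaves τ₀, σ.tileSet τ = σ.tileSet τ₀) ?_ ?_ τ₀ h
  · intro τ h h1
    rw [leaves_of_scale_le_one hd h h1, Set.biUnion_singleton]
  · intro τ h ih
    rw [leaves_of_one_lt_scale hd h, tileSet_eq_iUnion_rule τ (one_pos.trans h).ne']
    simp only [Set.biUnion_iUnion]
    exact Set.iUnion₂_congr ih

lemma leaves_subset_of_descendant {τ₀ θ : PlacedTile d n} (h : σ.Descendant τ₀ θ) :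
    σ.leaves θ ⊆ σ.leaves τ₀ := fun _ hτ => ⟨h.trans hτ.1, hτ.2⟩

/-- Leaves below one child are separated by induction; leaves below different children lie inside
those children, whose interiors are disjoint by the substitution rule. -/
lemma leaves_pairwise (hd : 0 < d) (τ₀ : PlacedTile d n) (h : 0 < τ₀.scale) :
    (σ.leaves τ₀).Pairwise fun τ ρ =>
      Disjoint (interior (σ.tileSet τ)) (interior (σ.tileSet ρ)) := by
  refine substitution_induction (σ := σ)
    (p := fun τ₀ => (σ.leaves τ₀).Pairwise fun τ ρ =>
      Disjoint (interior (σ.tileSet τ)) (interior (σ.tileSet ρ))) ?_ ?_ τ₀ h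
  · intro τ h h1
    rw [leaves_of_scale_le_one hd h h1]
    exact Set.pairwise_singleton _ _
  · intro τ h ih a ha b hb hab
    have hτ := one_pos.trans h
    rw [leaves_of_one_lt_scale hd h] at ha hb
    simp only [Set.mem_iUnion, exists_prop] at ha hb
    obtain ⟨ρ, hρ, ha⟩ := ha
    obtain ⟨ρ', hρ', hb⟩ := hb
    by_cases he : ρ = ρ'
    · subst he
      exact ih ρ hρ ha hb hab
    · have h1 := (σ.tessellation τ.label).disjoint_interior hρ hρ' he
      have h2 : Disjoint (interior (σ.tileSet (τ.place ρ)))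
          (interior (σ.tileSet (τ.place ρ'))) := by
        simp only [tileSet]
        rw [PlacedTile.support_place _ _ _ hτ.ne', PlacedTile.support_place _ _ _ hτ.ne',
          ← Homeomorph.image_interior, ← Homeomorph.image_interior]
        exact (Set.disjoint_image_iff (Homeomorph.injective _)).2 h1
      exact h2.mono (interior_mono (ha.1.tileSet_subset (mul_pos hτ (rule_scale_pos hρ))))
        (interior_mono (hb.1.tileSet_subset (mul_pos hτ (rule_scale_pos hρ'))))

/-- A similarity that does not move tiles across the unit volume threshold commutes with
substitution. -/
lemma leaves_place (hd : 0 < d) {κ τ₀ : PlacedTile d n} (hκ : 0 < κ.scale) (h0 : 0 < τ₀.scale)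
    (h : ∀ τ, σ.Descendant τ₀ τ → (1 < τ.scale ↔ 1 < κ.scale * τ.scale)) :
    σ.leaves (κ.place τ₀) = κ.place '' σ.leaves τ₀ := by
  have hv : ∀ τ, σ.Descendant τ₀ τ →
      (1 < volume (σ.tileSet τ) ↔ 1 < volume (σ.tileSet (κ.place τ))) := by
    intro τ hτ
    rw [one_lt_volume_tileSet_iff hd (hτ.scale_pos h0), h τ hτ,
      one_lt_volume_tileSet_iff hd (mul_pos hκ (hτ.scale_pos h0) : 0 < (κ.place τ).scale)]
    rfl
  have h1 : ∀ τ, σ.Descendant τ₀ τ → σ.Descendant (κ.place τ₀) (κ.place τ) := by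
    intro τ hτ
    induction hτ with
    | refl => exact .refl
    | step τ ρ hd' hv' hρ ih =>
      rw [← PlacedTile.place_assoc]
      exact ih.step _ _ ((hv τ hd').1 hv') hρ
  have h2 : ∀ τ', σ.Descendant (κ.place τ₀) τ' → ∃ τ, σ.Descendant τ₀ τ ∧ κ.place τ = τ' := by
    intro τ' hτ'
    induction hτ' with
    | refl => exact ⟨τ₀, .refl, rfl⟩
    | step τ ρ hd' hv' hρ ih =>
      obtain ⟨τ, hτ, rfl⟩ := ih
      exact ⟨τ.place ρ, hτ.step _ _ ((hv τ hτ).2 hv') hρ, (PlacedTile.place_assoc _ _ _).symm⟩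
  ext τ'
  constructor
  · rintro ⟨hτ', hvol⟩
    obtain ⟨τ, hτ, rfl⟩ := h2 τ' hτ'
    exact ⟨τ, ⟨hτ, not_lt.1 fun hc => not_lt.2 hvol ((hv τ hτ).1 hc)⟩, rfl⟩
  · rintro ⟨τ, ⟨hτ, hvol⟩, rfl⟩
    exact ⟨h1 τ hτ, not_lt.1 fun hc => not_lt.2 hvol ((hv τ hτ).2 hc)⟩

lemma flow_eq_leaves (t : ℝ) (i : Fin n) : σ.flow t i = σ.leaves ⟨i, Real.exp t, 0⟩ := rfl

lemma flowSupport_eq (hd : 0 < d) (t : ℝ) (i : Fin n) :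
    σ.flowSupport t i = σ.tileSet ⟨i, Real.exp t, 0⟩ :=
  iUnion_leaves hd _ (Real.exp_pos t)

/-- Substituting a translate of `e^t T_i` gives a translate of `F_t(T_i)`. -/
lemma leaves_eq_translate_flow (hd : 0 < d) (i : Fin n) (t : ℝ) (w : Space d) :
    σ.leaves ⟨i, Real.exp t, w⟩ = (fun τ => τ.translate w) '' σ.flow t i := by
  have h := leaves_place (σ := σ) hd (κ := ⟨i, 1, w⟩) (τ₀ := ⟨i, Real.exp t, 0⟩) one_pos
    (Real.exp_pos t) fun τ _ => by simp
  have h1 : ∀ τ : PlacedTile d n, (⟨i, 1, w⟩ : PlacedTile d n).place τ = τ.translate w := by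
    intro τ; simp [PlacedTile.place, PlacedTile.translate]
  have h2 : (⟨i, 1, w⟩ : PlacedTile d n).place = fun τ => τ.translate w := funext h1
  rw [h2] at h
  rw [flow_eq_leaves]
  simpa [PlacedTile.translate] using h

lemma translate_injective (w : Space d) :
    Function.Injective fun τ : PlacedTile d n => τ.translate w := by
  rintro ⟨l, a, p⟩ ⟨l', a', p'⟩ he
  simpa [PlacedTile.translate] using he

lemma ncard_leaves (hd : 0 < d) (i : Fin n) (t : ℝ) (w : Space d) :
    (σ.leaves ⟨i, Real.exp t, w⟩).ncard = (σ.flow t i).ncard := by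
  rw [leaves_eq_translate_flow hd, Set.ncard_image_of_injective _ (translate_injective w)]

end SubstitutionScheme

/-! ### Asymptotic density of path lengths -/

/-- Nonnegative integer combinations of two positive reals with irrational ratio are
asymptotically dense. -/
lemma exists_nat_combination {a b : ℝ} (ha : 0 < a) (hab : Irrational (a / b))
    {ε : ℝ} (hε : 0 < ε) :
    ∃ U : ℝ, ∀ u, U ≤ u → ∃ m k : ℕ, u - ε < m * a + k * b ∧ m * a + k * b ≤ u := by
  have hdense := dense_addSubgroupClosure_pair_iff.2 hab
  obtain ⟨δ, hδ, h0, h1⟩ := hdense.exists_between hε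
  obtain ⟨p, q, hpq⟩ := AddSubgroup.mem_closure_pair.1 hδ
  simp only [zsmul_eq_mul] at hpq
  obtain ⟨M, hM⟩ := exists_nat_gt (a / δ)
  -- Here `δ = p a + q b` may have a negative coefficient. This base point has enough copies of `a`
  -- and `b` in reserve to add `δ` up to `M` times with both coefficients nonnegative. Copies of `a`
  -- bring the sum within `a` of `u`, and `M > a / δ` small steps cover the rest.
  refine ⟨M * (|p| * a + |q| * b), fun u hu => ?_⟩
  set B : ℝ := M * (|p| * a + |q| * b) with hB
  set N := ⌊(u - B) / a⌋₊
  have hN0 : 0 ≤ (u - B) / a := div_nonneg (by linarith) ha.le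
  have hN1 : N * a ≤ u - B := (le_div_iff₀ ha).1 (Nat.floor_le hN0)
  have hN2 : u - B < (N + 1) * a := (div_lt_iff₀ ha).1 (Nat.lt_floor_add_one _)
  set r := u - B - N * a
  set k := ⌊r / δ⌋₊
  have hr : 0 ≤ r := by simp only [r]; linarith
  have hk1 : k * δ ≤ r := (le_div_iff₀ h0).1 (Nat.floor_le (div_nonneg hr h0.le))
  have hk2 : r < (k + 1) * δ := (div_lt_iff₀ h0).1 (Nat.lt_floor_add_one _)
  have hkM : k ≤ M := by
    refine Nat.floor_le_of_le (le_trans ?_ hM.le)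
    gcongr
    simp only [r]; linarith
  have hcoef : ∀ z : ℤ, ∃ c : ℕ, (c : ℝ) = M * |z| + k * z := by
    intro z
    have : 0 ≤ (M : ℤ) * |z| + k * z := by
      have h1 : -|z| ≤ z := neg_abs_le z
      have h2 : (k : ℤ) ≤ M := by exact_mod_cast hkM
      have h3 : (0 : ℤ) ≤ k := by positivity
      nlinarith [abs_nonneg z]
    obtain ⟨c, hc⟩ := Int.eq_ofNat_of_zero_le this
    refine ⟨c, ?_⟩
    have : ((M : ℤ) * |z| + k * z : ℝ) = ((c : ℤ) : ℝ) := by exact_mod_cast hc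
    push_cast at this ⊢
    linarith
  obtain ⟨c1, hc1⟩ := hcoef p
  obtain ⟨c2, hc2⟩ := hcoef q
  refine ⟨c1 + N, c2, ?_⟩
  have hval : ((c1 + N : ℕ) : ℝ) * a + c2 * b = B + k * δ + N * a := by
    push_cast
    rw [hc1, hc2, ← hpq, hB]
    push_cast
    ring
  rw [hval]
  simp only [r] at hk1 hk2
  constructor
  · nlinarith
  · linarith

namespace SubstitutionScheme

variable (σ : SubstitutionScheme d n)

/-- `σ.Path i j l`: the graph of the scheme has a directed path of length `l` from `i` to `j`. -/
inductive Path (i : Fin n) : Fin n → ℝ → Prop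
  | nil : Path i i 0
  | cons (j : Fin n) (l : ℝ) (ρ : PlacedTile d n) : Path i j l → ρ ∈ σ.rule j →
      Path i ρ.label (l - Real.log ρ.scale)

variable {σ}

namespace Path

lemma trans {i j k : Fin n} {l m : ℝ} (h : σ.Path i j l) (h' : σ.Path j k m) :
    σ.Path i k (l + m) := by
  induction h' with
  | nil => simpa using h
  | cons k m ρ _ hρ ih => rw [← add_sub_assoc]; exact ih.cons _ _ _ hρ

lemma nsmul {i : Fin n} {l : ℝ} (h : σ.Path i i l) (m : ℕ) : σ.Path i i (m * l) := by
  induction m with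
  | zero => simpa using .nil
  | succ m ih => push_cast; rw [add_mul, one_mul]; exact ih.trans h

/-- Substitution follows a path as long as the current tile is larger than one; the bound on `l`
guarantees this at each stage, because partial lengths are smaller. -/
lemma exists_descendant (hd : 0 < d) {i j : Fin n} {l : ℝ} (h : σ.Path i j l)
    (θ : PlacedTile d n) (hθ : 0 < θ.scale) (hi : θ.label = i) (hl : l < Real.log θ.scale) :
    ∃ τ, σ.Descendant θ τ ∧ τ.label = j ∧ τ.scale = Real.exp (Real.log θ.scale - l) := by
  induction h with
  | nil => exact ⟨θ, .refl, hi, by rw [sub_zero, Real.exp_log hθ]⟩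
  | cons j l ρ _ hρ ih =>
    have hlog : Real.log ρ.scale < 0 :=
      Real.log_neg (rule_scale_pos hρ) (σ.scale_lt_one _ _ hρ)
    obtain ⟨τ, hτ, rfl, hs⟩ := ih (by linarith)
    have hv : 1 < volume (σ.tileSet τ) := by
      rw [one_lt_volume_tileSet_iff hd (hτ.scale_pos hθ), hs]
      exact Real.one_lt_exp_iff.2 (by linarith)
    refine ⟨τ.place ρ, hτ.step _ _ hv hρ, rfl, ?_⟩
    change τ.scale * ρ.scale = _
    rw [hs, ← sub_add, Real.exp_add, Real.exp_log (rule_scale_pos hρ)]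

end Path

lemma Descendant.path {τ₀ τ : PlacedTile d n} (h : σ.Descendant τ₀ τ) (h0 : 0 < τ₀.scale) :
    σ.Path τ₀.label τ.label (Real.log τ₀.scale - Real.log τ.scale) := by
  induction h with
  | refl => rw [sub_self]; exact .nil
  | step τ ρ hτ _ hρ ih =>
    have h1 := ih.cons _ _ _ hρ
    have h2 : Real.log (τ.place ρ).scale = Real.log τ.scale + Real.log ρ.scale :=
      Real.log_mul (hτ.scale_pos h0).ne' (rule_scale_pos hρ).ne'
    rw [h2, ← sub_sub]
    exact h1

lemma Irreducible.exists_path (h : σ.Irreducible) (i j : Fin n) : ∃ l, σ.Path i j l := by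
  obtain ⟨t, -, τ, hτ, rfl⟩ := h i j
  exact ⟨_, hτ.1.path (Real.exp_pos t)⟩

lemma path_of_mem_returnTimes (hd : 0 < d) {i : Fin n} {t : ℝ} (h : t ∈ σ.returnTimes i) :
    σ.Path i i t := by
  obtain ⟨-, τ, ⟨hτ, -⟩, hl, hv⟩ := h
  have hpos := hτ.scale_pos (Real.exp_pos t)
  have h1 : τ.scale = 1 := by
    refine le_antisymm ((volume_tileSet_le_one_iff hd hpos).1 hv.le) (not_lt.1 fun hc => ?_)
    rw [σ.volume_tileSet τ hpos.le] at hv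
    have := ENNReal.ofReal_lt_one.2 (pow_lt_one₀ hpos.le hc hd.ne')
    exact absurd hv this.ne
  have h2 := hτ.path (Real.exp_pos t)
  rw [hl, h1] at h2
  simpa using h2

/-- In an irreducible incommensurable scheme the path lengths are asymptotically dense. -/
lemma exists_path_length_mem (hd : 0 < d) (hirr : σ.Irreducible) (hinc : σ.Incommensurable)
    (j : Fin n) {ε : ℝ} (hε : 0 < ε) :
    ∃ U : ℝ, ∀ u, U ≤ u → ∀ i, ∃ l, u - ε < l ∧ l ≤ u ∧ σ.Path i j l := by
  obtain ⟨a, b, t₁, h1, t₂, h2, hirrat⟩ := hinc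
  have hratio : Irrational (t₁ / t₂) := by
    rintro ⟨q, hq⟩
    exact hirrat q (by rw [hq, div_mul_cancel₀ _ h2.1.ne'])
  obtain ⟨U, hU⟩ := exists_nat_combination h1.1 hratio hε
  choose L hL using fun i => hirr.exists_path i a
  obtain ⟨L', hL'⟩ := hirr.exists_path a b
  obtain ⟨L'', hL''⟩ := hirr.exists_path b j
  -- The path goes from `i` to `a`, makes `m` loops there, moves on to `b`, makes `k` loops there
  -- and ends at `j`. The sum of all `|L i|` makes the threshold uniform in `i`.
  refine ⟨U + L' + L'' + ∑ i, |L i|, fun u hu i => ?_⟩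
  have hi := Finset.single_le_sum (f := fun i => |L i|) (fun i _ => abs_nonneg _)
    (Finset.mem_univ i)
  have hi' := le_abs_self (L i)
  obtain ⟨m, k, hm, hk⟩ := hU (u - L' - L'' - L i) (by linarith)
  refine ⟨L i + m * t₁ + L' + k * t₂ + L'', by linarith, by linarith, ?_⟩
  exact ((((hL i).trans ((path_of_mem_returnTimes hd h1).nsmul m)).trans hL').trans
    ((path_of_mem_returnTimes hd h2).nsmul k)).trans hL''

end SubstitutionScheme

/-! ### From Chabauty–Fell convergence of boundaries to convergence of similarities -/

/-- A coordinate attains its maximum over the closure of a bounded set at a boundary point. -/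
lemma exists_frontier_coord_max {A : Set (Space d)} (hb : Bornology.IsBounded A)
    (hne : A.Nonempty) (m : Fin d) (c : ℝ) (hc : c ≠ 0) :
    ∃ f ∈ frontier A, ∀ x ∈ closure A, c * x m ≤ c * f m := by
  have hcomp : IsCompact (closure A) := hb.isCompact_closure
  obtain ⟨f, hf, hmax⟩ := hcomp.exists_isMaxOn hne.closure
    (f := fun x : Space d => c * x m) (by fun_prop)
  refine ⟨f, ⟨hf, fun hint => ?_⟩, fun x hx => hmax hx⟩
  obtain ⟨ε, hε, hball⟩ := Metric.isOpen_iff.1 isOpen_interior f hint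
  -- A maximizer in the interior could be moved in the direction of the sign of `c`, increasing the
  -- value.
  have h1 : f + (ε / 2 * SignType.sign c) • EuclideanSpace.single m (1 : ℝ) ∈ Metric.ball f ε := by
    rw [Metric.mem_ball, dist_eq_norm, add_sub_cancel_left, norm_smul]
    have : |(SignType.sign c : ℝ)| ≤ 1 := by
      rcases lt_trichotomy c 0 with h | h | h <;> simp [h, sign_neg, sign_pos]
    simp only [Real.norm_eq_abs, abs_mul, PiLp.norm_single, abs_one, mul_one]
    rw [abs_of_pos (half_pos hε)]
    nlinarith
  have h2 : c * _ ≤ c * _ := hmax (subset_closure (interior_subset (hball h1)))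
  have h3 : c * (SignType.sign c : ℝ) = |c| := by rw [mul_comm]; exact sign_mul_self c
  simp only [PiLp.add_apply, PiLp.smul_apply, PiLp.single_apply, if_true, smul_eq_mul,
    mul_one] at h2
  have h4 : 0 < |c| * ε := mul_pos (abs_pos.2 hc) hε
  nlinarith

/-- Below one, the default value 1 in the infimum plays no role, and an admissible radius stays
admissible when enlarged: the ball shrinks and the thickening grows. -/
lemma exists_of_chabautyFellDist_lt {A B : Set (Space d)} {r : ℝ} (hr : r < 1)
    (h : chabautyFellDist A B < r) :
    0 < r ∧ A ∩ Metric.ball 0 (1 / r) ⊆ Metric.cthickening r B ∧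
      B ∩ Metric.ball 0 (1 / r) ⊆ Metric.cthickening r A := by
  obtain ⟨s, hs, hsr⟩ := exists_lt_of_csInf_lt ⟨1, Set.mem_union_right _ (Set.mem_singleton 1)⟩ h
  rcases hs with ⟨h0, h1, h2⟩ | hs
  · have hb : Metric.ball (0 : Space d) (1 / r) ⊆ Metric.ball 0 (1 / s) :=
      Metric.ball_subset_ball (one_div_le_one_div_of_le h0 hsr.le)
    exact ⟨h0.trans hsr, ((Set.inter_subset_inter_right _ hb).trans h1).trans
      (Metric.cthickening_mono hsr.le _), ((Set.inter_subset_inter_right _ hb).trans h2).trans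
      (Metric.cthickening_mono hsr.le _)⟩
  · rw [Set.mem_singleton_iff.1 hs] at hsr
    linarith

lemma exists_dist_le_of_mem_cthickening {A : Set (Space d)} (hA : IsCompact A) {r : ℝ}
    (hr : 0 ≤ r) {x : Space d} (hx : x ∈ Metric.cthickening r A) : ∃ y ∈ A, dist x y ≤ r := by
  rw [hA.cthickening_eq_biUnion_closedBall hr] at hx
  simpa using hx

/-- If the boundaries of uniformly bounded similar copies of a compact set converge in the
Chabauty--Fell metric to a similar copy, then the copies are eventually close to it in the
Hausdorff sense. -/
lemma eventually_near_of_tendsto_chabautyFellDist {F : Set (Space d)} (hF : IsCompact F)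
    (hne : F.Nonempty) {a : ℝ} {w : Space d} {b : ℕ → ℝ} {v : ℕ → Space d}
    (hb0 : ∀ k, 0 < b k) (hb1 : ∀ k, b k ≤ 1)
    (h : Tendsto (fun k => chabautyFellDist ((fun x => b k • x + v k) '' F)
      ((fun x => a • x + w) '' F)) atTop (𝓝 0)) {r : ℝ} (hr : 0 < r) :
    ∀ᶠ k in atTop, (∀ f ∈ F, ∃ g ∈ F, dist (a • f + w) (b k • g + v k) ≤ r) ∧
      (∀ g ∈ F, ∃ f ∈ F, dist (a • f + w) (b k • g + v k) ≤ r) := by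
  obtain ⟨D, hD⟩ := hF.isBounded.exists_norm_le
  obtain ⟨f₀, hf₀⟩ := hne
  have hD0 : 0 ≤ D := (norm_nonneg _).trans (hD f₀ hf₀)
  -- `R` bounds the norm on the limit copy, plus an error of at most one, plus the diameter of an
  -- approximating copy, with room to spare. Once `1 / s ≥ R`, the metric sees both copies entirely.
  set R := |a| * D + ‖w‖ + 1 + 2 * D + 1 with hR
  have hR1 : 1 < R := by
    have : 0 ≤ |a| * D := by positivity
    have := norm_nonneg w
    linarith
  set s := min r (1 / R) with hs
  have hs0 : 0 < s := lt_min hr (by positivity)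
  have hs1 : s < 1 := (min_le_right _ _).trans_lt ((div_lt_one (by linarith)).2 hR1)
  have hsR : R ≤ 1 / s := by
    rw [le_div_iff₀ hs0]
    calc R * s ≤ R * (1 / R) := by gcongr; exact min_le_right _ _
      _ = 1 := by field_simp
  have hcomp : ∀ (a : ℝ) (w : Space d), IsCompact ((fun x => a • x + w) '' F) := fun a w =>
    hF.image (by fun_prop)
  have hbound : ∀ f ∈ F, ‖a • f + w‖ ≤ |a| * D + ‖w‖ := fun f hf => by
    refine (norm_add_le _ _).trans ?_
    rw [norm_smul, Real.norm_eq_abs]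
    gcongr
    exact hD f hf
  filter_upwards [h.eventually (gt_mem_nhds hs0)] with k hk
  obtain ⟨-, h1, h2⟩ := exists_of_chabautyFellDist_lt hs1 hk
  have key : ∀ f ∈ F, ∃ g ∈ F, dist (a • f + w) (b k • g + v k) ≤ s := by
    intro f hf
    have h3 := h2 ⟨Set.mem_image_of_mem _ hf, by
      rw [Metric.mem_ball, dist_zero_right]
      have := hbound f hf
      linarith⟩
    obtain ⟨y, ⟨g, hg, rfl⟩, hy⟩ := exists_dist_le_of_mem_cthickening (hcomp _ _) hs0.le h3
    exact ⟨g, hg, hy⟩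
  constructor
  · intro f hf
    obtain ⟨g, hg, hy⟩ := key f hf
    exact ⟨g, hg, hy.trans (min_le_left _ _)⟩
  · intro g hg
    -- The copies are not known to be bounded in advance: one point near the limit copy anchors each
    -- of them, and `b k ≤ 1` bounds the diameter.
    obtain ⟨g₀, hg₀, hy₀⟩ := key f₀ hf₀
    have h3 := h1 ⟨Set.mem_image_of_mem _ hg, by
      rw [Metric.mem_ball, dist_zero_right]
      have e : b k • g + v k = b k • (g - g₀) + ((b k • g₀ + v k) - (a • f₀ + w))
          + (a • f₀ + w) := by
        rw [smul_sub]; abel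
      have e1 : ‖b k • (g - g₀)‖ ≤ 2 * D := by
        rw [norm_smul, Real.norm_eq_abs, abs_of_pos (hb0 k)]
        have e2 : ‖g - g₀‖ ≤ 2 * D := by
          have := norm_sub_le g g₀
          have := hD g hg
          have := hD g₀ hg₀
          linarith
        calc b k * ‖g - g₀‖ ≤ 1 * ‖g - g₀‖ := by gcongr; exact hb1 k
          _ ≤ 2 * D := by linarith
      have e3 : ‖(b k • g₀ + v k) - (a • f₀ + w)‖ ≤ s := by
        rw [← dist_eq_norm, dist_comm]; exact hy₀
      rw [e]
      have e4 := norm_add₃_le (a := b k • (g - g₀)) (b := (b k • g₀ + v k) - (a • f₀ + w))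
        (c := a • f₀ + w)
      have e5 := hbound f₀ hf₀
      linarith⟩
    obtain ⟨y, ⟨f, hf, rfl⟩, hy⟩ := exists_dist_le_of_mem_cthickening (hcomp _ _) hs0.le h3
    exact ⟨f, hf, by rw [dist_comm]; exact hy.trans (min_le_left _ _)⟩

/-- Convergence of the boundaries of similar copies of a bounded set forces convergence of the
similarities. -/
lemma tendsto_similarity_of_chabautyFellDist (hd : 0 < d) {A : Set (Space d)}
    (hA : Bornology.IsBounded A) (hint : (interior A).Nonempty) {a : ℝ} {w : Space d}
    (ha : 0 ≤ a) {b : ℕ → ℝ} {v : ℕ → Space d} (hb0 : ∀ k, 0 < b k) (hb1 : ∀ k, b k ≤ 1)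
    (h : Tendsto (fun k => chabautyFellDist ((fun x => b k • x + v k) '' frontier A)
      ((fun x => a • x + w) '' frontier A)) atTop (𝓝 0)) :
    Tendsto b atTop (𝓝 a) ∧ Tendsto v atTop (𝓝 w) := by
  have hAne : A.Nonempty := hint.mono interior_subset
  have hFc : IsCompact (frontier A) :=
    hA.isCompact_closure.of_isClosed_subset isClosed_frontier frontier_subset_closure
  -- Similarities of nonnegative scale preserve coordinate extrema, so the same `f` is extremal in
  -- every copy, and extremal values of Hausdorff-close sets are close.
  have hcoord : ∀ (m : Fin d) (c : ℝ) (f : Space d), c ≠ 0 → f ∈ frontier A →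
      (∀ x ∈ closure A, c * x m ≤ c * f m) →
      Tendsto (fun k => b k * f m + v k m) atTop (𝓝 (a * f m + w m)) := by
    intro m c f hc hf hmax
    rw [Metric.tendsto_atTop]
    intro ε hε
    have hev := eventually_near_of_tendsto_chabautyFellDist hFc ⟨f, hf⟩ hb0 hb1 h (half_pos hε)
    obtain ⟨N, hN⟩ := eventually_atTop.1 hev
    refine ⟨N, fun k hk => ?_⟩
    obtain ⟨g1, hg1, h1⟩ := (hN k hk).1 f hf
    obtain ⟨g2, hg2, h2⟩ := (hN k hk).2 f hf
    have hco : ∀ x y : Space d, dist (a • x + w) (b k • y + v k) ≤ ε / 2 →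
        |(a * x m + w m) - (b k * y m + v k m)| ≤ ε / 2 := by
      intro x y hxy
      rw [dist_eq_norm] at hxy
      have := PiLp.norm_apply_le ((a • x + w) - (b k • y + v k)) m
      simp only [PiLp.sub_apply, PiLp.add_apply, PiLp.smul_apply, smul_eq_mul,
        Real.norm_eq_abs] at this
      exact this.trans hxy
    have e1 := abs_le.1 (hco _ _ h1)
    have e2 := abs_le.1 (hco _ _ h2)
    have m1 := hmax g1 (frontier_subset_closure hg1)
    have m2 := hmax g2 (frontier_subset_closure hg2)
    have hbk := hb0 k
    rw [Real.dist_eq]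
    refine lt_of_le_of_lt (abs_le.2 ?_) (half_lt_self hε)
    rcases lt_or_gt_of_ne hc with hc | hc
    · have m1' : f m ≤ g1 m := (mul_le_mul_left_of_neg hc).1 m1
      have m2' : f m ≤ g2 m := (mul_le_mul_left_of_neg hc).1 m2
      constructor <;> nlinarith
    · have m1' : g1 m ≤ f m := le_of_mul_le_mul_of_pos_left m1 hc
      have m2' : g2 m ≤ f m := le_of_mul_le_mul_of_pos_left m2 hc
      constructor <;> nlinarith
  have hlim : Tendsto b atTop (𝓝 a) := by
    set m : Fin d := ⟨0, hd⟩
    obtain ⟨f, hf, hfm⟩ := exists_frontier_coord_max hA hAne m 1 one_ne_zero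
    obtain ⟨g, hg, hgm⟩ := exists_frontier_coord_max hA hAne m (-1) (by norm_num)
    -- The width in direction `m` is positive because the interior is nonempty; dividing by it
    -- recovers the scale.
    have hlt : g m < f m := by
      obtain ⟨p, hp⟩ := hint
      obtain ⟨ε, hε, hball⟩ := Metric.isOpen_iff.1 isOpen_interior p hp
      have h1 : p + (ε / 2) • EuclideanSpace.single m (1 : ℝ) ∈ Metric.ball p ε := by
        rw [Metric.mem_ball, dist_eq_norm, add_sub_cancel_left, norm_smul]
        simp only [Real.norm_eq_abs, PiLp.norm_single, abs_one, mul_one]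
        rw [abs_of_pos (half_pos hε)]
        linarith
      have h2 := hfm _ (subset_closure (interior_subset (hball h1)))
      have h3 := hgm _ (subset_closure (interior_subset hp))
      simp only [PiLp.add_apply, PiLp.smul_apply, PiLp.single_apply, if_true, smul_eq_mul,
        mul_one, one_mul] at h2
      linarith
    have h1 := ((hcoord m 1 f one_ne_zero hf hfm).sub
      (hcoord m (-1) g (by norm_num) hg hgm)).div_const (f m - g m)
    have h2 : f m - g m ≠ 0 := (sub_pos.2 hlt).ne'
    refine (h1.congr fun k => ?_).trans_eq ?_
    · field_simp
      ring
    · congr 1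
      field_simp
      ring
  refine ⟨hlim, ?_⟩
  have hv : ∀ m, Tendsto (fun k => v k m) atTop (𝓝 (w m)) := by
    intro m
    obtain ⟨f, hf, hfm⟩ := exists_frontier_coord_max hA hAne m 1 one_ne_zero
    have h1 := (hcoord m 1 f one_ne_zero hf hfm).sub (hlim.mul_const (f m))
    simpa using h1
  have h2 : Tendsto (fun k => WithLp.toLp 2 (fun m => v k m)) atTop
      (𝓝 (WithLp.toLp 2 (fun m => w m))) :=
    ((PiLp.continuous_toLp 2 _).tendsto _).comp (tendsto_pi_nhds.2 hv)
  exact h2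

/-! ### Crossing the boundary of a set -/

lemma exists_mem_segment_frontier {U : Set (Space d)} {x y : Space d} (hx : x ∈ U) (hy : y ∉ U) :
    ∃ z ∈ segment ℝ x y, z ∈ frontier U := by
  by_contra! hcon
  have hpre : IsPreconnected (segment ℝ x y) := (convex_segment x y).isPreconnected
  have hmem : ∀ z ∈ segment ℝ x y, z ∈ interior U ∨ z ∈ (closure U)ᶜ := fun z hz => by
    by_cases h : z ∈ closure U
    · exact Or.inl (by_contra fun h' => hcon z hz ⟨h, h'⟩)
    · exact Or.inr h
  obtain ⟨z, -, hz1, hz2⟩ := hpre _ _ isOpen_interior isClosed_closure.isOpen_compl hmem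
    ⟨x, left_mem_segment ℝ x y, (hmem x (left_mem_segment ℝ x y)).resolve_right
      fun h => h (subset_closure hx)⟩
    ⟨y, right_mem_segment ℝ x y, (hmem y (right_mem_segment ℝ x y)).resolve_left
      fun h => hy (interior_subset h)⟩
  exact hz2 (subset_closure (interior_subset hz1))

/-- The segment between the points meets the frontier. Bounded displacements across the boundary
thus cost only the volume of a boundary neighbourhood. -/
lemma mem_cthickening_frontier {U : Set (Space d)} {x y : Space d} {c : ℝ} (hx : x ∈ U)
    (hy : y ∉ U) (hxy : dist x y ≤ c) :
    x ∈ Metric.cthickening c (frontier U) ∧ y ∈ Metric.cthickening c (frontier U) := by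
  obtain ⟨z, hz, hzU⟩ := exists_mem_segment_frontier hx hy
  have hc : 0 ≤ c := dist_nonneg.trans hxy
  have h1 : z ∈ Metric.closedBall x c := (convex_closedBall x c).segment_subset
    (Metric.mem_closedBall_self hc) (by rwa [Metric.mem_closedBall, dist_comm]) hz
  have h2 : z ∈ Metric.closedBall y c := (convex_closedBall y c).segment_subset
    (by rwa [Metric.mem_closedBall]) (Metric.mem_closedBall_self hc) hz
  exact ⟨Metric.mem_cthickening_of_dist_le _ _ _ _ hzU (by rwa [dist_comm]),
    Metric.mem_cthickening_of_dist_le _ _ _ _ hzU (by rwa [dist_comm])⟩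

/-! ### Half-open cubes of a cubic lattice -/

/-- The half-open cube of side length `α` with lower corner `z`. -/
def cube (α : ℝ) (z : Space d) : Set (Space d) := {x | ∀ m, z m ≤ x m ∧ x m < z m + α}

lemma cube_eq_preimage (α : ℝ) (z : Space d) :
    cube α z = (MeasurableEquiv.toLp 2 (Fin d → ℝ)).symm ⁻¹'
      (Set.univ.pi fun m => Set.Ico (z m) (z m + α)) := by
  ext x
  simp [cube]

lemma measurableSet_cube (α : ℝ) (z : Space d) : MeasurableSet (cube α z) := by
  rw [cube_eq_preimage]
  exact (MeasurableEquiv.measurable _)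
    (MeasurableSet.univ_pi fun m => measurableSet_Ico)

lemma volume_cube {α : ℝ} (hα : 0 ≤ α) (z : Space d) :
    volume (cube α z) = ENNReal.ofReal (α ^ d) := by
  rw [cube_eq_preimage,
    (EuclideanSpace.volume_preserving_symm_measurableEquiv_toLp (Fin d)).measure_preimage
      (MeasurableSet.univ_pi fun m => measurableSet_Ico).nullMeasurableSet, Real.volume_pi_Ico]
  simp [ENNReal.ofReal_pow hα]

lemma dist_le_of_mem_cube {α : ℝ} (hd : 0 < d) {x z : Space d} (hx : x ∈ cube α z) :
    dist x z ≤ d * α := by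
  have hα : 0 ≤ α := by
    have := hx ⟨0, hd⟩
    linarith
  rw [EuclideanSpace.dist_eq]
  refine Real.sqrt_le_iff.2 ⟨by positivity, ?_⟩
  calc ∑ m, dist (x m) (z m) ^ 2 ≤ ∑ _m : Fin d, α ^ 2 := by
        refine Finset.sum_le_sum fun m _ => ?_
        have := hx m
        rw [Real.dist_eq, sq_abs]
        nlinarith
    _ = d * α ^ 2 := by simp
    _ ≤ (d * α) ^ 2 := by
        have : (1 : ℝ) ≤ d := by exact_mod_cast hd
        nlinarith [mul_nonneg (by linarith : (0 : ℝ) ≤ d) (sq_nonneg α)]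

lemma exists_mem_cube {α : ℝ} (hα : 0 < α) (x : Space d) :
    ∃ z ∈ scaledIntegerLattice d α, x ∈ cube α z := by
  refine ⟨WithLp.toLp 2 fun m => α * ⌊x m / α⌋, ⟨fun m => ⌊x m / α⌋, fun m => rfl⟩, fun m => ?_⟩
  have h1 := (le_div_iff₀ hα).1 (Int.floor_le (x m / α))
  have h2 := (div_lt_iff₀ hα).1 (Int.lt_floor_add_one (x m / α))
  constructor
  · change α * _ ≤ _
    linarith
  · change _ < α * _ + α
    linarith

lemma cube_disjoint {α : ℝ} (hα : 0 < α) {z z' : Space d} (hz : z ∈ scaledIntegerLattice d α)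
    (hz' : z' ∈ scaledIntegerLattice d α) (hne : z ≠ z') : Disjoint (cube α z) (cube α z') := by
  rw [Set.disjoint_left]
  intro x hx hx'
  apply hne
  obtain ⟨a, ha⟩ := hz
  obtain ⟨b, hb⟩ := hz'
  ext m
  have h1 := hx m
  have h2 := hx' m
  rw [ha m] at h1 ⊢
  rw [hb m] at h2 ⊢
  have h3 : a m < b m + 1 := by
    have : α * a m < α * (b m + 1) := by linarith
    exact_mod_cast lt_of_mul_lt_mul_left this hα.le
  have h4 : b m < a m + 1 := by
    have : α * b m < α * (a m + 1) := by linarith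
    exact_mod_cast lt_of_mul_lt_mul_left this hα.le
  have h5 : a m = b m := by omega
  rw [h5]

lemma finite_lattice_inter_closedBall {α : ℝ} (hα : 0 < α) (R : ℝ) :
    (scaledIntegerLattice d α ∩ Metric.closedBall 0 R).Finite := by
  obtain ⟨N, hN⟩ := exists_nat_ge (R / α)
  refine ((Set.finite_Icc (fun _ : Fin d => -(N : ℤ)) fun _ => (N : ℤ)).image
    fun z => WithLp.toLp 2 fun m => α * (z m : ℝ)).subset ?_
  rintro x ⟨⟨z, hz⟩, hx⟩
  rw [mem_closedBall_zero_iff] at hx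
  have hzm : ∀ m, |(z m : ℝ)| ≤ N := fun m => by
    have h1 := (PiLp.norm_apply_le x m).trans hx
    rw [hz m, Real.norm_eq_abs, abs_mul, abs_of_pos hα] at h1
    refine le_trans ?_ hN
    rw [le_div_iff₀ hα]
    linarith
  refine ⟨z, ⟨fun m => ?_, fun m => ?_⟩, ?_⟩
  · exact_mod_cast (abs_le.1 (hzm m)).1
  · exact_mod_cast (abs_le.1 (hzm m)).2
  · ext m
    exact (hz m).symm

/-- Counting lattice points: if, near `U`, the finite set `Z` consists of exactly the lattice points
that belong to `U` up to a bounded displacement, then the volume of the cubes of `Z` is that of `U`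
up to the volume of a neighbourhood of the boundary of `U`. -/
lemma lattice_count_vs_volume (hd : 0 < d) {α c₁ c₂ : ℝ} (hα : 0 < α) {U : Set (Space d)}
    {Z : Finset (Space d)} (hZ : (Z : Set (Space d)) ⊆ scaledIntegerLattice d α)
    (hc : d * α + c₁ ≤ c₂) (hin : ∀ z ∈ Z, ∃ x ∈ U, dist z x ≤ c₁)
    (hout : ∀ z ∈ scaledIntegerLattice d α, z ∉ Z → ∀ x ∈ U, dist x z ≤ d * α →
      ∃ y ∉ U, dist x y ≤ c₂) :
    ENNReal.ofReal (α ^ d) * Z.card ≤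
        volume U + volume (Metric.cthickening c₂ (frontier U)) ∧
      volume U ≤ ENNReal.ofReal (α ^ d) * Z.card +
        volume (Metric.cthickening c₂ (frontier U)) := by
  have hvol : volume (⋃ z ∈ Z, cube α z) = ENNReal.ofReal (α ^ d) * Z.card := by
    rw [measure_biUnion_finset]
    · simp [volume_cube hα.le, mul_comm]
    · intro z hz z' hz' hne
      exact cube_disjoint hα (hZ hz) (hZ hz') hne
    · exact fun z _ => measurableSet_cube α z
  rw [← hvol]
  constructor
  · refine (measure_mono fun x hx => ?_).trans (measure_union_le _ _)
    by_cases hxU : x ∈ U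
    · exact Or.inl hxU
    · obtain ⟨z, hz, hxz⟩ := Set.mem_iUnion₂.1 hx
      obtain ⟨y, hy, hzy⟩ := hin z hz
      refine Or.inr (mem_cthickening_frontier hy hxU ?_).2
      rw [dist_comm]
      exact (dist_triangle _ z _).trans ((add_le_add (dist_le_of_mem_cube hd hxz) hzy).trans hc)
  · refine (measure_mono fun x hx => ?_).trans (measure_union_le _ _)
    obtain ⟨z, hz, hxz⟩ := exists_mem_cube hα x
    by_cases hzZ : z ∈ Z
    · exact Or.inl (Set.mem_iUnion₂.2 ⟨z, hzZ, hxz⟩)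
    · obtain ⟨y, hy, hxy⟩ := hout z hz hzZ x hx (dist_le_of_mem_cube hd hxz)
      exact Or.inr (mem_cthickening_frontier hx hy hxy).1

/-! ### Matching a tiling with generating patches and with the lattice -/

namespace SubstitutionScheme

variable {σ : SubstitutionScheme d n}

lemma dist_le_of_mem_tileSet {D : ℝ} (hD : ∀ i, ∀ x ∈ σ.prototile i, ‖x‖ ≤ D)
    {τ : PlacedTile d n} (h : 0 ≤ τ.scale) {x y : Space d} (hx : x ∈ σ.tileSet τ)
    (hy : y ∈ σ.tileSet τ) : dist x y ≤ τ.scale * (2 * D) := by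
  obtain ⟨f, hf, rfl⟩ := hx
  obtain ⟨g, hg, rfl⟩ := hy
  simp only [dist_add_right, dist_smul₀, Real.norm_eq_abs, abs_of_nonneg h]
  gcongr
  rw [dist_eq_norm]
  have := norm_sub_le f g
  have := hD _ f hf
  have := hD _ g hg
  linarith

lemma isBounded_tileSet (τ : PlacedTile d n) : Bornology.IsBounded (σ.tileSet τ) := by
  obtain ⟨D, hD⟩ := (σ.isTile τ.label).bounded.exists_norm_le
  refine isBounded_iff_forall_norm_le.2 ⟨|τ.scale| * D + ‖τ.pos‖, ?_⟩
  rintro _ ⟨x, hx, rfl⟩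
  refine (norm_add_le _ _).trans ?_
  rw [norm_smul, Real.norm_eq_abs]
  gcongr
  exact hD x hx

/-- Convergence in the definition of the tiling space is convergence of scales and positions. -/
lemma tendsto_of_tendsto_frontier (hd : 0 < d) {τ : PlacedTile d n} (hτ : 0 < τ.scale)
    {t : ℕ → ℝ} {i : ℕ → Fin n} {v : ℕ → Space d} {τ' : ℕ → PlacedTile d n}
    (hflow : ∀ k, τ' k ∈ σ.flow (t k) (i k)) (hlabel : ∀ k, (τ' k).label = τ.label)
    (h : Tendsto (fun k => chabautyFellDist (frontier (σ.tileSet ((τ' k).translate (v k))))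
      (frontier (σ.tileSet τ))) atTop (𝓝 0)) :
    Tendsto (fun k => (τ' k).scale) atTop (𝓝 τ.scale) ∧
      Tendsto (fun k => (τ' k).pos + v k) atTop (𝓝 τ.pos) := by
  have hpos : ∀ k, 0 < (τ' k).scale := fun k => (hflow k).1.scale_pos (Real.exp_pos _)
  have hint : (interior (σ.prototile τ.label)).Nonempty := by
    have := interior_tileSet_nonempty (σ := σ) (τ := ⟨τ.label, 1, 0⟩) one_pos
    simpa [tileSet, PlacedTile.support] using this
  refine tendsto_similarity_of_chabautyFellDist hd (σ.isTile τ.label).bounded hint hτ.le hpos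
    (fun k => (volume_tileSet_le_one_iff hd (hpos k)).1 (hflow k).2) ?_
  refine h.congr fun k => ?_
  have h1 : ((τ' k).translate (v k)).scale ≠ 0 := (hpos k).ne'
  simp only [tileSet]
  rw [PlacedTile.frontier_support _ _ h1, PlacedTile.frontier_support _ _ hτ.ne']
  simp only [PlacedTile.translate, hlabel k]

lemma scale_le_one_of_mem_tilingSpace (hd : 0 < d) {𝒯 : Set (PlacedTile d n)}
    (h𝒯 : 𝒯 ∈ σ.tilingSpace) {τ : PlacedTile d n} (hτ : τ ∈ 𝒯) : τ.scale ≤ 1 := by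
  obtain ⟨t, i, v, φ, h1, h2⟩ := h𝒯.2 {τ} (by simpa using hτ)
  have hflow := fun k => ((h1 k).2.2 τ (Finset.mem_singleton_self τ)).1
  refine le_of_tendsto (tendsto_of_tendsto_frontier hd (h𝒯.1.scale_pos τ hτ) hflow
    (fun k => ((h1 k).2.2 τ (Finset.mem_singleton_self τ)).2)
    (h2 τ (Finset.mem_singleton_self τ))).1 (Eventually.of_forall fun k => ?_)
  exact (volume_tileSet_le_one_iff hd ((hflow k).1.scale_pos (Real.exp_pos _))).1 (hflow k).2

lemma volume_closure_tileSet (τ : PlacedTile d n) (h : 0 < τ.scale) :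
    volume (closure (σ.tileSet τ)) = ENNReal.ofReal (τ.scale ^ d) := by
  rw [← σ.volume_tileSet τ h.le]
  refine le_antisymm ?_ (measure_mono subset_closure)
  rw [closure_eq_self_union_frontier]
  exact (measure_union_le _ _).trans (by rw [σ.volume_frontier_tileSet τ h, add_zero])

/-- Tiles with pairwise disjoint interiors inside a set have total volume at most that of the
set. -/
lemma sum_volume_le (P : Finset (PlacedTile d n)) (hP : ∀ τ ∈ P, 0 < τ.scale)
    (hdisj : (P : Set (PlacedTile d n)).Pairwise fun τ ρ =>
      Disjoint (interior (σ.tileSet τ)) (interior (σ.tileSet ρ))) {U : Set (Space d)}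
    (hU : ∀ τ ∈ P, σ.tileSet τ ⊆ U) :
    ENNReal.ofReal (∑ τ ∈ P, τ.scale ^ d) ≤ volume U := by
  have h1 : volume (⋃ τ ∈ P, interior (σ.tileSet τ)) = ENNReal.ofReal (∑ τ ∈ P, τ.scale ^ d) := by
    rw [measure_biUnion_finset hdisj fun τ _ => isOpen_interior.measurableSet,
      ENNReal.ofReal_sum_of_nonneg fun τ hτ => pow_nonneg (hP τ hτ).le d]
    refine Finset.sum_congr rfl fun τ hτ => ?_
    rw [σ.volume_interior_tileSet τ (hP τ hτ), σ.volume_tileSet τ (hP τ hτ).le]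
  rw [← h1]
  exact measure_mono (Set.iUnion₂_subset fun τ hτ => interior_subset.trans (hU τ hτ))

/-- A large finite part of a tiling in the tiling space is matched, up to a bounded displacement,
with tiles of a patch generated by substitution, which exhaust the patch in a given ball. -/
lemma exists_leaves_matching (hd : 0 < d) {𝒯 : Set (PlacedTile d n)} (h𝒯 : 𝒯 ∈ σ.tilingSpace)
    {D : ℝ} (hD0 : 0 < D) (hD : ∀ i, ∀ x ∈ σ.prototile i, ‖x‖ ≤ D) {Q : Finset (PlacedTile d n)}
    (hQ : (Q : Set (PlacedTile d n)) ⊆ 𝒯) {R : ℝ}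
    (hcov : Metric.closedBall 0 R ⊆ ⋃ τ ∈ Q, σ.tileSet τ) :
    ∃ τ₀ : PlacedTile d n, 1 ≤ τ₀.scale ∧ ∃ ψ : PlacedTile d n → PlacedTile d n,
      Set.InjOn ψ Q ∧ (∀ τ ∈ Q, ψ τ ∈ σ.leaves τ₀ ∧
        ∀ x ∈ σ.tileSet τ, ∀ y ∈ σ.tileSet (ψ τ), dist x y ≤ 2 * D + 1) ∧
      ∀ ρ ∈ σ.leaves τ₀, σ.tileSet ρ ⊆ Metric.closedBall 0 R → ∃ τ ∈ Q, ψ τ = ρ := by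
  classical
  obtain ⟨β, hβ0, hβ1, hβ⟩ := σ.exists_scale_lower
  obtain ⟨t, i, v, φ, h1, h2⟩ := h𝒯.2 Q hQ
  have hpos : ∀ τ ∈ Q, 0 < τ.scale := fun τ hτ => h𝒯.1.scale_pos τ (hQ hτ)
  have hlim := fun τ (hτ : τ ∈ Q) => tendsto_of_tendsto_frontier hd (hpos τ hτ)
    (fun k => ((h1 k).2.2 τ hτ).1) (fun k => ((h1 k).2.2 τ hτ).2) (h2 τ hτ)
  set K : Set (Space d) := ⋃ τ ∈ Q, σ.tileSet τ with hK
  set V : ℝ := ∑ τ ∈ Q, τ.scale ^ d with hV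
  have hKb : Bornology.IsBounded K :=
    (Bornology.isBounded_biUnion Q.finite_toSet).2 fun τ _ => isBounded_tileSet τ
  have hKvol : volume (closure K) ≤ ENNReal.ofReal V := by
    rw [hK, Finset.closure_biUnion, hV,
      ENNReal.ofReal_sum_of_nonneg fun τ hτ => pow_nonneg (hpos τ hτ).le d]
    refine (measure_biUnion_finset_le _ _).trans (Finset.sum_le_sum fun τ hτ => ?_)
    rw [volume_closure_tileSet τ (hpos τ hτ)]
  have hβd : 0 < β ^ d := pow_pos hβ0 d
  have hV0 : 0 ≤ V := Finset.sum_nonneg fun τ hτ => pow_nonneg (hpos τ hτ).le d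
  -- Every leaf has volume at least `β ^ d`. Half of this is allowed for the thickening of `K`, half
  -- for the change of scales in `hsum`.
  obtain ⟨ε, hε0, hε1, hεK⟩ : ∃ ε : ℝ, 0 < ε ∧ ε ≤ 1 ∧
      volume (Metric.cthickening ε K) < ENNReal.ofReal (V + β ^ d / 2) := by
    have ht := tendsto_measure_cthickening (μ := (volume : Measure (Space d))) (s := K)
      ⟨1, one_pos, (hKb.cthickening.measure_lt_top).ne⟩
    have hlt : volume (closure K) < ENNReal.ofReal (V + β ^ d / 2) :=
      hKvol.trans_lt ((ENNReal.ofReal_lt_ofReal_iff (by positivity)).2 (by linarith))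
    obtain ⟨ε, hε0, hε⟩ := Metric.eventually_nhds_iff.1 (ht.eventually (gt_mem_nhds hlt))
    refine ⟨min (ε / 2) 1, lt_min (half_pos hε0) one_pos, min_le_right _ _, hε ?_⟩
    rw [Real.dist_eq, sub_zero, abs_of_pos (lt_min (half_pos hε0) one_pos)]
    exact (min_le_left _ _).trans_lt (half_lt_self hε0)
  have hclose : ∀ᶠ k in atTop, ∀ τ ∈ Q,
      |τ.scale - (φ k τ).scale| * D + ‖τ.pos - ((φ k τ).pos + v k)‖ < ε := by
    rw [Finset.eventually_all]
    intro τ hτ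
    have e1 := ((hlim τ hτ).1.const_sub τ.scale).abs.mul_const D
    have e2 := ((hlim τ hτ).2.const_sub τ.pos).norm
    have e3 := e1.add e2
    simp only [sub_self, abs_zero, zero_mul, norm_zero, add_zero] at e3
    exact e3.eventually (gt_mem_nhds hε0)
  have hsum : ∀ᶠ k in atTop, V - β ^ d / 2 < ∑ τ ∈ Q, (φ k τ).scale ^ d := by
    have := tendsto_finsetSum Q fun τ hτ => (hlim τ hτ).1.pow d
    exact this.eventually (lt_mem_nhds (by linarith))
  obtain ⟨k, hk1, hk2⟩ := (hclose.and hsum).exists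
  have hroot : 1 ≤ Real.exp (t k) := Real.one_le_exp (h1 k).1
  have hleaf : ∀ τ ∈ Q, (φ k τ).translate (v k) ∈ σ.leaves ⟨i k, Real.exp (t k), v k⟩ := by
    intro τ hτ
    rw [leaves_eq_translate_flow hd]
    exact Set.mem_image_of_mem _ ((h1 k).2.2 τ hτ).1
  have hleafpos : ∀ ρ ∈ σ.leaves ⟨i k, Real.exp (t k), v k⟩, 0 < ρ.scale := fun ρ hρ =>
    hρ.1.scale_pos (Real.exp_pos _)
  have hnear : ∀ τ ∈ Q, ∀ g ∈ σ.prototile τ.label,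
      dist (τ.scale • g + τ.pos) ((φ k τ).scale • g + ((φ k τ).pos + v k)) ≤ ε := by
    intro τ hτ g hg
    have e : τ.scale • g + τ.pos - ((φ k τ).scale • g + ((φ k τ).pos + v k))
        = (τ.scale - (φ k τ).scale) • g + (τ.pos - ((φ k τ).pos + v k)) := by
      rw [sub_smul]; abel
    rw [dist_eq_norm, e]
    refine (norm_add_le _ _).trans (le_trans ?_ (hk1 τ hτ).le)
    rw [norm_smul, Real.norm_eq_abs]
    gcongr
    exact hD _ g hg
  have hmem : ∀ τ ∈ Q, ∀ y ∈ σ.tileSet ((φ k τ).translate (v k)), ∃ g ∈ σ.prototile τ.label,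
      (φ k τ).scale • g + ((φ k τ).pos + v k) = y := by
    rintro τ hτ y ⟨g, hg, rfl⟩
    refine ⟨g, ?_, rfl⟩
    rw [← ((h1 k).2.2 τ hτ).2]
    exact hg
  have hinj : Set.InjOn (fun τ => (φ k τ).translate (v k)) Q := fun a ha b hb hab =>
    (h1 k).2.1 ha hb (translate_injective (v k) hab)
  refine ⟨⟨i k, Real.exp (t k), v k⟩, hroot, fun τ => (φ k τ).translate (v k), hinj,
    fun τ hτ => ⟨hleaf τ hτ, ?_⟩, ?_⟩
  · rintro x hx y hy
    obtain ⟨g, hg, rfl⟩ := hmem τ hτ y hy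
    have e1 := hnear τ hτ g hg
    have e2 := dist_le_of_mem_tileSet hD (hpos τ hτ).le hx (Set.mem_image_of_mem _ hg)
    have e3 := scale_le_one_of_mem_tilingSpace hd h𝒯 (hQ hτ)
    have e4 := dist_triangle x (τ.scale • g + τ.pos)
      ((φ k τ).scale • g + ((φ k τ).pos + v k))
    nlinarith
  · intro ρ hρ hρR
    by_contra! hcon
    set P : Finset (PlacedTile d n) := Q.image fun τ => (φ k τ).translate (v k) with hP
    have hρP : ρ ∉ P := by
      rw [hP, Finset.mem_image]
      rintro ⟨τ, hτ, h⟩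
      exact hcon τ hτ h
    have hsub : ∀ τ ∈ insert ρ P, τ ∈ σ.leaves ⟨i k, Real.exp (t k), v k⟩ := by
      intro τ hτ
      rcases Finset.mem_insert.1 hτ with rfl | hτ
      · exact hρ
      · obtain ⟨τ', hτ', rfl⟩ := Finset.mem_image.1 hτ
        exact hleaf τ' hτ'
    -- An unmatched leaf inside the ball and the matched leaves are packed into the thickening of
    -- `K`; their volume exceeds `V + β ^ d / 2`, which is too much.
    have hle := sum_volume_le (σ := σ) (insert ρ P) (fun τ hτ => hleafpos τ (hsub τ hτ))
      ((leaves_pairwise hd _ (Real.exp_pos _)).mono hsub) (U := Metric.cthickening ε K) <| by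
        intro τ hτ
        rcases Finset.mem_insert.1 hτ with rfl | hτ
        · exact (hρR.trans hcov).trans (Metric.self_subset_cthickening _)
        · obtain ⟨τ', hτ', rfl⟩ := Finset.mem_image.1 hτ
          intro y hy
          obtain ⟨g, hg, rfl⟩ := hmem τ' hτ' y hy
          refine Metric.mem_cthickening_of_dist_le _ (τ'.scale • g + τ'.pos) _ _
            (Set.mem_iUnion₂.2 ⟨τ', hτ', Set.mem_image_of_mem _ hg⟩) ?_
          rw [dist_comm]
          exact hnear τ' hτ' g hg
    have hlt := (ENNReal.ofReal_lt_ofReal_iff (by positivity)).1 (hle.trans_lt hεK)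
    rw [Finset.sum_insert hρP, hP, Finset.sum_image hinj] at hlt
    have hρβ : β ^ d ≤ ρ.scale ^ d :=
      pow_le_pow_left₀ hβ0.le (hρ.1.le_scale hd hβ1 hβ hroot) d
    simp only [PlacedTile.translate] at hlt
    linarith

/-- By translation invariance, the boundary hypothesis on generating patches applies to tiles found
anywhere. -/
lemma volume_cthickening_frontier_tileSet (hd : 0 < d) (j : Fin n) (s c : ℝ) (w : Space d) :
    volume (Metric.cthickening c (frontier (σ.tileSet ⟨j, Real.exp s, w⟩))) =
      volume (Metric.cthickening c (frontier (σ.flowSupport s j))) := by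
  rw [flowSupport_eq hd]
  have h1 : σ.tileSet ⟨j, Real.exp s, w⟩ =
      IsometryEquiv.addRight w '' σ.tileSet ⟨j, Real.exp s, 0⟩ := by
    simp only [tileSet, PlacedTile.support, Set.image_image]
    exact Set.image_congr fun x _ => by simp
  have h2 : frontier (σ.tileSet ⟨j, Real.exp s, w⟩) =
      IsometryEquiv.addRight w '' frontier (σ.tileSet ⟨j, Real.exp s, 0⟩) := by
    rw [h1]
    exact ((IsometryEquiv.addRight w).toHomeomorph.image_frontier _).symm
  rw [h2, ← measure_preimage_add_right volume w (Metric.cthickening c _)]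
  congr 1
  ext x
  simp only [Set.mem_preimage, Metric.mem_cthickening_iff]
  rw [← Metric.infEDist_image (IsometryEquiv.addRight w).isometry (x := x)
    (t := frontier (σ.tileSet ⟨j, Real.exp s, 0⟩))]
  rfl

/-- A leaf of a larger tile which is not a leaf of the tile `θ` is not contained in `θ`. -/
lemma exists_mem_tileSet_notMem (hd : 0 < d) {τ₀ θ τ : PlacedTile d n} (h0 : 0 < τ₀.scale)
    (hθ : σ.Descendant τ₀ θ) (hfin : (σ.leaves θ).Finite) (hτ : τ ∈ σ.leaves τ₀)
    (hτθ : τ ∉ σ.leaves θ) : ∃ y ∈ σ.tileSet τ, y ∉ σ.tileSet θ := by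
  by_contra! hcon
  -- Otherwise the open set `interior τ`, disjoint from the interiors of the leaves covering `θ`,
  -- would lie in finitely many null boundaries.
  have hsub : interior (σ.tileSet τ) ⊆ ⋃ ρ ∈ σ.leaves θ, frontier (σ.tileSet ρ) := by
    intro x hx
    have h1 := hcon x (interior_subset hx)
    rw [← iUnion_leaves hd θ (hθ.scale_pos h0)] at h1
    obtain ⟨ρ, hρ, hxρ⟩ := Set.mem_iUnion₂.1 h1
    refine Set.mem_iUnion₂.2 ⟨ρ, hρ, subset_closure hxρ, fun hint => ?_⟩
    have hne : τ ≠ ρ := fun h => hτθ (h ▸ hρ)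
    exact Set.disjoint_left.1 (leaves_pairwise hd τ₀ h0 hτ
      (leaves_subset_of_descendant hθ hρ) hne) hx hint
  have hzero : volume (⋃ ρ ∈ σ.leaves θ, frontier (σ.tileSet ρ)) = 0 :=
    (measure_biUnion_null_iff hfin.countable).2 fun ρ hρ =>
      σ.volume_frontier_tileSet ρ (hρ.1.scale_pos (hθ.scale_pos h0))
  exact (isOpen_interior.measure_pos volume
    (interior_tileSet_nonempty (σ := σ) (hτ.1.scale_pos h0))).ne' (measure_mono_null hsub hzero)

/-- If some tiling in the tiling space is uniformly spread, then, at a dense set of times, the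
number of tiles of the generating patches is proportional to their volume, up to the volume of a
neighbourhood of the boundary of the support. -/
lemma exists_discrepancy_bound (hd : 0 < d) (hirr : σ.Irreducible) (hinc : σ.Incommensurable)
    {𝒯 : Set (PlacedTile d n)} (h𝒯 : 𝒯 ∈ σ.tilingSpace) (hspread : σ.UniformlySpread 𝒯) :
    ∃ α : ℝ, 0 < α ∧ ∃ c : ℝ, 0 < c ∧ ∀ (j : Fin n) (s δ : ℝ), 0 < s → 0 < δ →
      ∃ s', s ≤ s' ∧ s' < s + δ ∧
        |α ^ d * ((σ.flow s' j).ncard : ℝ) - Real.exp s' ^ d| ≤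
          (volume (Metric.cthickening c (frontier (σ.flowSupport s' j)))).toReal := by
  classical
  obtain ⟨y, hyinj, hymem, α, hα, φ, hφ, C₀, hC₀⟩ := hspread
  obtain ⟨D, hD0, hD⟩ := σ.exists_prototile_norm_le
  obtain ⟨β, hβ0, hβ1, hβ⟩ := σ.exists_scale_lower
  set g : PlacedTile d n → Space d := fun τ => φ (y τ)
  have hg : Set.BijOn g 𝒯 (scaledIntegerLattice d α) := hφ.comp hyinj.bijOn_image
  obtain ⟨C, hC0, hC⟩ : ∃ C : ℝ, 0 ≤ C ∧ ∀ τ ∈ 𝒯, dist (y τ) (g τ) ≤ C :=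
    ⟨|C₀|, abs_nonneg _, fun τ hτ => by
      rw [dist_eq_norm]
      exact (hC₀ _ (Set.mem_image_of_mem y hτ)).trans (le_abs_self _)⟩
  set E : ℝ := 2 * D + 1 with hE
  refine ⟨α, hα, d * α + (C + E), by positivity, fun j s δ hs hδ => ?_⟩
  obtain ⟨U, hU⟩ := exists_path_length_mem hd hirr hinc j hδ
  set b : ℝ := Real.exp (|U| + s) with hb
  have hb1 : 1 < b := Real.one_lt_exp_iff.2 (by positivity)
  -- `R₀` bounds the distance from the origin to points of the tile `θ` found below: `E` reaches a
  -- matched leaf, and the rest is the diameter of its ancestor. In `R`, the term `d * α + C`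
  -- captures tiles whose lattice points lie near `θ`, and the last bracket forces the root to have
  -- scale at least `b`.
  set R₀ : ℝ := E + b / β * (2 * D) with hR₀
  set R : ℝ := R₀ + (d * α + C) + (b * (2 * D) + 2 * E) with hR
  have hdα : 0 ≤ d * α := by positivity
  have hb2 : 0 ≤ b * (2 * D) := by positivity
  have hb3 : 0 ≤ b / β * (2 * D) := by positivity
  -- Local finiteness is not part of the definition of a tiling; here it is inherited from the
  -- lattice through the injection `g`.
  have hfinQ : {τ ∈ 𝒯 | (σ.tileSet τ ∩ Metric.closedBall 0 R).Nonempty}.Finite := by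
    refine Set.Finite.of_finite_image (f := g)
      ((finite_lattice_inter_closedBall hα (C + 2 * D + R)).subset ?_)
      (hg.injOn.mono fun τ hτ => hτ.1)
    rintro _ ⟨τ, ⟨hτ, x, hxτ, hxR⟩, rfl⟩
    refine ⟨hg.mapsTo hτ, ?_⟩
    have e1 := hC τ hτ
    have e2 := dist_le_of_mem_tileSet hD (h𝒯.1.scale_pos τ hτ).le (hymem τ hτ) hxτ
    have e3 := scale_le_one_of_mem_tilingSpace hd h𝒯 hτ
    rw [Metric.mem_closedBall] at hxR ⊢
    have e4 := dist_triangle4 (g τ) (y τ) x 0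
    rw [dist_comm] at e1
    nlinarith
  set Q : Finset (PlacedTile d n) := hfinQ.toFinset with hQ
  have hQmem : ∀ τ ∈ 𝒯, ∀ x ∈ σ.tileSet τ, dist x 0 ≤ R → τ ∈ Q := fun τ hτ x hx hxR =>
    hfinQ.mem_toFinset.2 ⟨hτ, x, hx, hxR⟩
  have hQ𝒯 : (Q : Set (PlacedTile d n)) ⊆ 𝒯 := fun τ hτ => (hfinQ.mem_toFinset.1 hτ).1
  have hcover : ∀ x : Space d, ∃ τ ∈ 𝒯, x ∈ σ.tileSet τ := fun x => by
    have := (h𝒯.1.cover.symm ▸ Set.mem_univ x : x ∈ ⋃ τ ∈ 𝒯, τ.support σ.prototile)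
    simpa [tileSet] using this
  obtain ⟨τ₀, hτ₀, ψ, hψinj, hψ, hψall⟩ := exists_leaves_matching hd h𝒯 hD0 hD hQ𝒯 (R := R) <| by
    intro x hx
    obtain ⟨τ, hτ, hxτ⟩ := hcover x
    exact Set.mem_iUnion₂.2 ⟨τ, hQmem τ hτ x hxτ hx, hxτ⟩
  have h0 : 0 < τ₀.scale := one_pos.trans_le hτ₀
  obtain ⟨τa, hτa, hxa⟩ := hcover 0
  obtain ⟨τb, hτb, hxb⟩ := hcover (EuclideanSpace.single ⟨0, hd⟩ R)
  have hxR : dist (EuclideanSpace.single ⟨0, hd⟩ R : Space d) 0 = R := by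
    rw [dist_zero_right, PiLp.norm_single, Real.norm_of_nonneg (by linarith)]
  have hQa := hQmem τa hτa _ hxa (by rw [dist_self]; linarith)
  have hQb := hQmem τb hτb _ hxb hxR.le
  obtain ⟨pa, hpa⟩ := tileSet_nonempty (σ := σ) (ψ τa)
  obtain ⟨pb, hpb⟩ := tileSet_nonempty (σ := σ) (ψ τb)
  have hda := (hψ τa hQa).2 _ hxa _ hpa
  have hdb := (hψ τb hQb).2 _ hxb _ hpb
  have hbτ₀ : b ≤ τ₀.scale := by
    have e1 := dist_le_of_mem_tileSet hD h0.le ((hψ τb hQb).1.1.tileSet_subset h0 hpb)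
      ((hψ τa hQa).1.1.tileSet_subset h0 hpa)
    have e2 := dist_triangle4 (EuclideanSpace.single ⟨0, hd⟩ R : Space d) pb pa 0
    rw [hxR, dist_comm pa 0] at e2
    have e3 : b * (2 * D) ≤ τ₀.scale * (2 * D) := by linarith
    exact le_of_mul_le_mul_right e3 (by positivity)
  have hψa := (volume_tileSet_le_one_iff hd ((hψ τa hQa).1.1.scale_pos h0)).1 (hψ τa hQa).1.2
  obtain ⟨θ₁, hθ₁, hθ₁a, hbθ₁, hθ₁b⟩ := (hψ τa hQa).1.1.exists_ancestor hβ h0 hbτ₀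
    (hψa.trans_lt hb1)
  have hθ₁0 : 0 < θ₁.scale := hθ₁.scale_pos h0
  have hlog : |U| + s ≤ Real.log θ₁.scale := (Real.le_log_iff_exp_le hθ₁0).2 hbθ₁
  -- The choice of `b` puts this argument above `U`. The descendant at the end of the path has type
  -- `j` and scale `exp s'` with `s ≤ s' < s + δ`.
  obtain ⟨l, hl1, hl2, hpath⟩ := hU (Real.log θ₁.scale - s)
    (by linarith [le_abs_self U]) θ₁.label
  obtain ⟨θ, hθθ₁, hθl, hθs⟩ := hpath.exists_descendant hd θ₁ hθ₁0 rfl (by linarith)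
  set s' := Real.log θ₁.scale - l with hs'
  have hθ : σ.Descendant τ₀ θ := hθ₁.trans hθθ₁
  have hθ0 : 0 < θ.scale := hθ.scale_pos h0
  have hθball : ∀ x ∈ σ.tileSet θ, dist x 0 ≤ R₀ := by
    intro x hx
    have e1 := dist_le_of_mem_tileSet hD hθ₁0.le (hθθ₁.tileSet_subset hθ₁0 hx)
      (hθ₁a.tileSet_subset hθ₁0 hpa)
    have e2 := dist_triangle x pa 0
    rw [dist_comm pa 0] at e2
    have e3 : θ₁.scale ≤ b / β := ((lt_div_iff₀ hβ0).2 hθ₁b).le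
    have e4 : θ₁.scale * (2 * D) ≤ b / β * (2 * D) := by gcongr
    linarith
  set P : Finset (PlacedTile d n) := Q.filter fun τ => ψ τ ∈ σ.leaves θ with hP
  have hPQ : P ⊆ Q := Finset.filter_subset _ _
  have hleaves : σ.leaves θ = ((P.image ψ : Finset _) : Set (PlacedTile d n)) := by
    ext ρ
    rw [Finset.mem_coe, Finset.mem_image]
    constructor
    · intro hρ
      obtain ⟨τ, hτ, rfl⟩ := hψall ρ (leaves_subset_of_descendant hθ hρ) fun x hx => by
        have := hθball x (hρ.1.tileSet_subset hθ0 hx)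
        rw [Metric.mem_closedBall]
        linarith
      exact ⟨τ, Finset.mem_filter.2 ⟨hτ, hρ⟩, rfl⟩
    · rintro ⟨τ, hτ, rfl⟩
      exact (Finset.mem_filter.1 hτ).2
  have hcard : (σ.leaves θ).ncard = (P.image g).card := by
    rw [hleaves, Set.ncard_coe_finset, Finset.card_image_of_injOn (hψinj.mono hPQ),
      Finset.card_image_of_injOn (hg.injOn.mono fun τ hτ => hQ𝒯 (hPQ hτ))]
  have hfin : (σ.leaves θ).Finite := hleaves ▸ Finset.finite_toSet _
  have hcount := lattice_count_vs_volume hd hα (U := σ.tileSet θ) (Z := P.image g)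
    (c₁ := C + E) (c₂ := d * α + (C + E))
    (by
      intro z hz
      obtain ⟨τ, hτ, rfl⟩ := Finset.mem_image.1 hz
      exact hg.mapsTo (hQ𝒯 (hPQ hτ))) le_rfl
    (by
      intro z hz
      obtain ⟨τ, hτ, rfl⟩ := Finset.mem_image.1 hz
      have hτ𝒯 := hQ𝒯 (hPQ hτ)
      obtain ⟨x, hx⟩ := tileSet_nonempty (σ := σ) (ψ τ)
      refine ⟨x, (Finset.mem_filter.1 hτ).2.1.tileSet_subset hθ0 hx, ?_⟩
      refine (dist_triangle _ (y τ) _).trans (add_le_add ?_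
        ((hψ τ (hPQ hτ)).2 _ (hymem τ hτ𝒯) x hx))
      rw [dist_comm]
      exact hC τ hτ𝒯)
    (by
      -- A lattice point near `θ` outside the counted set belongs to a tile whose match is not a
      -- leaf of `θ`, hence sticks out of `θ`.
      intro z hz hzP x hx hxz
      obtain ⟨τ, hτ, rfl⟩ := hg.surjOn hz
      have e1 := hC τ hτ
      rw [dist_comm] at e1
      have hτQ : τ ∈ Q := by
        refine hQmem τ hτ (y τ) (hymem τ hτ) ?_
        have e2 := dist_triangle4 (y τ) (g τ) x 0
        have e3 := hθball x hx
        rw [dist_comm (y τ) (g τ), dist_comm (g τ) x] at e2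
        linarith
      have hψτ : ψ τ ∉ σ.leaves θ := fun h =>
        hzP (Finset.mem_image_of_mem g (Finset.mem_filter.2 ⟨hτQ, h⟩))
      obtain ⟨x', hx', hx'θ⟩ := exists_mem_tileSet_notMem hd h0 hθ hfin (hψ τ hτQ).1 hψτ
      refine ⟨x', hx'θ, ?_⟩
      have e2 := (hψ τ hτQ).2 _ (hymem τ hτ) x' hx'
      have e3 := dist_triangle4 x (g τ) (y τ) x'
      linarith)
  have hθeq : θ = ⟨j, Real.exp s', θ.pos⟩ := by
    ext1
    · exact hθl
    · exact hθs
    · rfl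
  have hbd : volume (Metric.cthickening (d * α + (C + E)) (frontier (σ.tileSet θ))) ≠ ⊤ :=
    (((isBounded_tileSet θ).closure.subset
      frontier_subset_closure).cthickening.measure_lt_top).ne
  rw [← hcard, σ.volume_tileSet θ hθ0.le, hθs] at hcount
  rw [hθeq, ncard_leaves hd] at hcount
  rw [hθeq] at hbd
  rw [volume_cthickening_frontier_tileSet hd] at hcount hbd
  refine ⟨s', by linarith, by linarith, ?_⟩
  set B := volume (Metric.cthickening (d * α + (C + E)) (frontier (σ.flowSupport s' j)))
  have hB : B = ENNReal.ofReal B.toReal := (ENNReal.ofReal_toReal hbd).symm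
  have hB0 : 0 ≤ B.toReal := ENNReal.toReal_nonneg
  have hN : ENNReal.ofReal (α ^ d) * ((σ.flow s' j).ncard : ENNReal) =
      ENNReal.ofReal (α ^ d * ((σ.flow s' j).ncard : ℝ)) := by
    rw [ENNReal.ofReal_mul (by positivity), ENNReal.ofReal_natCast]
  have hes : 0 ≤ Real.exp s' ^ d := by positivity
  rw [hN, hB, ← ENNReal.ofReal_add (by positivity) hB0,
    ← ENNReal.ofReal_add (by positivity) hB0, ENNReal.ofReal_le_ofReal_iff (by positivity),
    ENNReal.ofReal_le_ofReal_iff (by positivity)] at hcount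
  exact abs_le.2 ⟨by linarith [hcount.2], by linarith [hcount.1]⟩

end SubstitutionScheme

/-! ### Changing the radius of a boundary neighbourhood -/

/-- The volumes of the neighbourhoods of different radii of a set are comparable. -/
lemma volume_cthickening_le (c : ℝ) (hc : 0 ≤ c) : ∃ K : ℝ, 0 ≤ K ∧ ∀ A : Set (Space d),
    Bornology.IsBounded A → (volume (Metric.cthickening c A)).toReal ≤
      K * (volume (Metric.cthickening 1 A)).toReal := by
  set v₁ := volume (Metric.ball (0 : Space d) 1) with hv₁
  set v₂ := volume (Metric.ball (0 : Space d) (c + 2)) with hv₂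
  have h1 : v₁ ≠ 0 := (Metric.measure_ball_pos volume _ one_pos).ne'
  have h1' : v₁ ≠ ⊤ := measure_ball_lt_top.ne
  have h2' : v₂ ≠ ⊤ := measure_ball_lt_top.ne
  refine ⟨(v₂ / v₁).toReal, ENNReal.toReal_nonneg, fun A hA => ?_⟩
  rw [← ENNReal.toReal_mul]
  refine ENNReal.toReal_mono (ENNReal.mul_ne_top (ENNReal.div_ne_top h2' h1)
    hA.cthickening.measure_lt_top.ne) ?_
  set M := Metric.cthickening c A
  set N := Metric.cthickening 1 A
  have hMm : MeasurableSet M := Metric.isClosed_cthickening.measurableSet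
  -- Double counting of pairs in `M × N` at distance below `c + 2`: each `x ∈ M` is within `c + 1`
  -- of some `a ∈ A`, so it sees the unit ball around `a`, which lies in `N`.
  set f : Space d → Space d → ENNReal := fun x y =>
    Set.indicator {p : Space d × Space d | dist p.1 p.2 < c + 2} 1 (x, y) with hf
  have hmeas : MeasurableSet {p : Space d × Space d | dist p.1 p.2 < c + 2} :=
    (isOpen_lt (by fun_prop) (by fun_prop)).measurableSet
  have hpt : ∀ x ∈ M, v₁ ≤ ∫⁻ y in N, f x y := by
    intro x hx
    obtain ⟨a, ha, hxa⟩ := Metric.mem_thickening_iff.1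
      (Metric.cthickening_subset_thickening' (by linarith) (lt_add_one c) A hx)
    have hball : Metric.ball a 1 ⊆ N := fun y hy =>
      Metric.mem_cthickening_of_dist_le _ _ _ _ ha (Metric.mem_ball.1 hy).le
    calc v₁ = volume (Metric.ball a 1) := (Measure.addHaar_ball_center volume a 1).symm
      _ = ∫⁻ _y in Metric.ball a 1, 1 := by simp
      _ ≤ ∫⁻ y in Metric.ball a 1, f x y := by
          refine setLIntegral_mono' measurableSet_ball fun y hy => ?_
          have hxy : dist x y < c + 2 := by
            have := dist_triangle_right x y a
            have := Metric.mem_ball.1 hy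
            linarith
          simp only [hf]
          rw [Set.indicator_of_mem (show (x, y) ∈ {p : Space d × Space d | dist p.1 p.2 < c + 2}
            from hxy)]
          rfl
      _ ≤ _ := lintegral_mono_set hball
  have hswap : ∫⁻ x, ∫⁻ y in N, f x y = ∫⁻ y in N, ∫⁻ x, f x y :=
    lintegral_lintegral_swap ((measurable_one.indicator hmeas).aemeasurable)
  have hinner : ∀ y, ∫⁻ x, f x y = v₂ := by
    intro y
    have : (fun x => f x y) = (Metric.ball y (c + 2)).indicator 1 := by
      funext x
      simp only [hf, Set.indicator, Set.mem_ofPred_eq, Metric.mem_ball]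
      rfl
    rw [this, lintegral_indicator_one measurableSet_ball, Measure.addHaar_ball_center]
  have hfin : v₁ * volume M ≤ v₂ * volume N := by
    calc v₁ * volume M = ∫⁻ _x in M, v₁ := by rw [setLIntegral_const]
      _ ≤ ∫⁻ x in M, ∫⁻ y in N, f x y := setLIntegral_mono' hMm hpt
      _ ≤ ∫⁻ x, ∫⁻ y in N, f x y := setLIntegral_le_lintegral _ _
      _ = v₂ * volume N := by
          rw [hswap]
          simp only [hinner]
          rw [setLIntegral_const]
  calc volume M = (v₁ * volume M) / v₁ := by
        rw [mul_comm, ENNReal.mul_div_cancel_right h1 h1']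
    _ ≤ (v₂ * volume N) / v₁ := by gcongr
    _ = v₂ / v₁ * volume N := by rw [ENNReal.mul_div_right_comm]

/-! ### Jump times of the tile count -/

namespace SubstitutionScheme

variable {σ : SubstitutionScheme d n}

/-- The order of the edges is irrelevant to the length, so only the multiplicities of the scales
need counting. -/
lemma Path.exists_eq_sum {i j : Fin n} {l : ℝ} (h : σ.Path i j l) :
    ∃ k : ℝ → ℕ, l = ∑ x ∈ σ.scales, k x * -Real.log x := by
  induction h with
  | nil => exact ⟨0, by simp⟩
  | cons j l ρ _ hρ ih =>
    obtain ⟨k, rfl⟩ := ih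
    refine ⟨k + Pi.single ρ.scale 1, ?_⟩
    simp only [Pi.add_apply, Nat.cast_add, add_mul, Finset.sum_add_distrib]
    rw [Finset.sum_eq_single (f := fun x => (↑((Pi.single ρ.scale 1 : ℝ → ℕ) x) : ℝ) *
      -Real.log x) ρ.scale]
    · simp [sub_eq_add_neg]
    · intro x _ hx
      simp [hx]
    · exact fun h => absurd (scale_mem_scales hρ) h

/-- There are only polynomially many path lengths up to a given length. -/
lemma exists_finset_path_lengths (σ : SubstitutionScheme d n) : ∃ (p : ℕ) (B : ℝ),
    ∀ m : ℕ, ∃ J : Finset ℝ,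
      (J.card : ℝ) + 1 ≤ B * ((m : ℝ) + 1) ^ p ∧
      ∀ i j l, σ.Path i j l → l ≤ m + 1 → l ∈ J := by
  obtain ⟨β, hβ0, hβ1, hβ⟩ := σ.scales.exists_upper_lt_one fun x hx => (mem_scales_bounds hx).2
  have hc : 0 < -Real.log β := neg_pos.2 (Real.log_neg hβ0 hβ1)
  -- Every edge has length at least `-log β`, so each multiplicity is at most `A * (m + 1)`.
  obtain ⟨A, hA⟩ := exists_nat_ge (1 / -Real.log β)
  refine ⟨σ.scales.card, (A + 1 : ℝ) ^ σ.scales.card + 1, fun m => ?_⟩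
  refine ⟨(Fintype.piFinset fun _ : σ.scales => Finset.range (A * (m + 1) + 1)).image
    fun k => ∑ x : σ.scales, (k x : ℝ) * -Real.log x, ?_, ?_⟩
  · have h1 := Finset.card_image_le
      (s := Fintype.piFinset fun _ : σ.scales => Finset.range (A * (m + 1) + 1))
      (f := fun k => ∑ x : σ.scales, (k x : ℝ) * -Real.log x)
    rw [Fintype.card_piFinset, Finset.prod_const, Finset.card_range, Finset.card_univ,
      Fintype.card_coe] at h1
    have h2 : (A * (m + 1) + 1) ^ σ.scales.card ≤ ((A + 1) * (m + 1)) ^ σ.scales.card :=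
      Nat.pow_le_pow_left (by nlinarith) _
    have h3 : (1 : ℝ) ≤ ((m : ℝ) + 1) ^ σ.scales.card :=
      one_le_pow₀ (by linarith [Nat.cast_nonneg (α := ℝ) m])
    have h4 := Nat.cast_le (α := ℝ).2 (h1.trans h2)
    push_cast at h4
    rw [mul_pow] at h4
    linarith
  · intro i j l hl hlm
    obtain ⟨k, rfl⟩ := hl.exists_eq_sum
    refine Finset.mem_image.2 ⟨fun x => k x, ?_,
      Finset.sum_coe_sort σ.scales fun x => (k x : ℝ) * -Real.log x⟩
    rw [Fintype.mem_piFinset]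
    rintro ⟨x, hx⟩
    have hpos : ∀ x ∈ σ.scales, 0 ≤ (k x : ℝ) * -Real.log x := fun x hx =>
      mul_nonneg (Nat.cast_nonneg _)
        (neg_nonneg.2 (Real.log_nonpos (mem_scales_bounds hx).1.le (mem_scales_bounds hx).2.le))
    have h1 := (Finset.single_le_sum hpos hx).trans hlm
    have h2 : -Real.log β ≤ -Real.log x :=
      neg_le_neg (Real.log_le_log (mem_scales_bounds hx).1 (hβ x hx))
    have h3 : (k x : ℝ) * -Real.log β ≤ m + 1 :=
      (mul_le_mul_of_nonneg_left h2 (Nat.cast_nonneg _)).trans h1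
    have h4 : (k x : ℝ) ≤ A * (m + 1) := by
      calc (k x : ℝ) ≤ (m + 1) / -Real.log β := (le_div_iff₀ hc).2 h3
        _ = 1 / -Real.log β * (m + 1) := by ring
        _ ≤ A * (m + 1) := by gcongr
    exact Finset.mem_range.2 (Nat.lt_succ_of_le (by exact_mod_cast h4))

/-- The number of tiles in the generating patch changes only at path lengths. -/
lemma ncard_flow_eq (hd : 0 < d) {j : Fin n} {s s' : ℝ} (hs : s ≤ s')
    (h : ∀ k l, σ.Path j k l → s ≤ l → ¬ l < s') :
    (σ.flow s j).ncard = (σ.flow s' j).ncard := by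
  have h1 := leaves_place (σ := σ) hd (κ := ⟨j, Real.exp (s' - s), 0⟩)
    (τ₀ := ⟨j, Real.exp s, 0⟩) (Real.exp_pos _) (Real.exp_pos _) (by
      intro τ hτ
      have hτ0 := hτ.scale_pos (Real.exp_pos s)
      constructor
      · intro h1
        exact one_lt_mul_of_le_of_lt (Real.one_le_exp (by linarith)) h1
      · intro h1
        by_contra! h2
        -- A tile pushed across unit volume by the rescaling gives a path of length `s - log
        -- τ.scale`, which lies in `[s, s')`.
        have h3 := hτ.path (Real.exp_pos s)
        simp only [Real.log_exp] at h3
        refine h _ _ h3 (by linarith [Real.log_nonpos hτ0.le h2]) ?_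
        have h4 := Real.log_pos h1
        rw [Real.log_mul (Real.exp_pos _).ne' hτ0.ne', Real.log_exp] at h4
        linarith)
  have h2 : (⟨j, Real.exp (s' - s), 0⟩ : PlacedTile d n).place ⟨j, Real.exp s, 0⟩ =
      ⟨j, Real.exp s', 0⟩ := by
    simp [PlacedTile.place, ← Real.exp_add]
  rw [h2] at h1
  rw [flow_eq_leaves, flow_eq_leaves, h1,
    Set.ncard_image_of_injective _ (PlacedTile.place_injective _ (Real.exp_pos _).ne')]

end SubstitutionScheme

/-! ### Few jumps against exponential growth -/

/-- Among finitely many points, one of sufficiently many consecutive intervals is free. -/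
lemma exists_free_interval (J : Finset ℝ) (m : ℝ) : ∃ q : ℕ, q < J.card + 1 ∧
    ∀ l ∈ J, m + q / (J.card + 1 : ℝ) ≤ l → ¬ l < m + (q + 1) / (J.card + 1 : ℝ) := by
  set M : ℝ := J.card + 1 with hM
  have hM0 : 0 < M := by positivity
  obtain ⟨q, hq, hqJ⟩ := Finset.exists_mem_notMem_of_card_lt_card
    (s := J.image fun l => ⌊(l - m) * M⌋₊) (t := Finset.range (J.card + 1)) (by
      rw [Finset.card_range]
      exact Finset.card_image_le.trans_lt (Nat.lt_succ_self _))
  refine ⟨q, Finset.mem_range.1 hq, fun l hl h1 h2 => hqJ (Finset.mem_image.2 ⟨l, hl, ?_⟩)⟩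
  have h3 : (q : ℝ) ≤ (l - m) * M := (div_le_iff₀ hM0).1 (by linarith)
  have h4 : (l - m) * M < q + 1 := (lt_div_iff₀ hM0).1 (by linarith)
  exact (Nat.floor_eq_iff ((Nat.cast_nonneg q).trans h3)).2 ⟨h3, h4⟩

/-- A function that is constant between polynomially many jumps cannot approximate an exponential
function with a power saving. -/
lemma not_exponential_of_few_jumps {d : ℕ} (hd : 0 < d) {η K t₀ : ℝ} (hη : 0 < η) (N : ℝ → ℝ)
    (happ : ∀ s δ : ℝ, 0 < s → t₀ ≤ s → 0 < δ → ∃ s', s ≤ s' ∧ s' < s + δ ∧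
      |N s' - Real.exp s' ^ d| ≤ K * Real.exp ((d - η) * s'))
    {p : ℕ} {B : ℝ}
    (hjump : ∀ m : ℕ, ∃ J : Finset ℝ, (J.card : ℝ) + 1 ≤ B * ((m : ℝ) + 1) ^ p ∧
      ∀ s s' : ℝ, s ≤ s' → s' ≤ m + 1 → (∀ l ∈ J, s ≤ l → ¬ l < s') → N s = N s') : False := by
  have hlim := (tendsto_rpow_mul_exp_neg_mul_atTop_nhds_zero p η hη).const_mul
    (6 * |K| * Real.exp d * B * Real.exp η)
  rw [mul_zero] at hlim
  have hlim' := hlim.comp (tendsto_natCast_atTop_atTop.comp (tendsto_add_atTop_nat 1))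
  obtain ⟨m, hm1, hmt, hm0⟩ := ((hlim'.eventually (gt_mem_nhds one_pos)).and
    ((tendsto_natCast_atTop_atTop.eventually (eventually_ge_atTop t₀)).and
      (eventually_gt_atTop 0))).exists
  simp only [Function.comp_apply, Nat.cast_add, Nat.cast_one, Real.rpow_natCast] at hm1
  obtain ⟨J, hJ, hN⟩ := hjump m
  obtain ⟨q, hq, hfree⟩ := exists_free_interval J m
  set M : ℝ := J.card + 1 with hM
  have hM0 : 0 < M := by positivity
  have hq0 : 0 ≤ (q : ℝ) / M := by positivity
  have hq1 : ((q : ℝ) + 1) / M ≤ 1 := by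
    rw [div_le_one hM0, hM]
    exact_mod_cast hq
  have hqM : ((q : ℝ) + 1) / M = q / M + 3 * (1 / (3 * M)) := by field_simp
  have hδ : 0 < 1 / (3 * M) := by positivity
  set δ : ℝ := 1 / (3 * M) with hδdef
  have hm0' : (0 : ℝ) < m := by exact_mod_cast hm0
  -- The good times are taken in the first and last thirds of the free interval, so they are more
  -- than `δ` apart with no jump between them.
  obtain ⟨s, hs1, hs2, hs⟩ := happ (m + q / M) δ (by linarith) (by linarith) hδ
  obtain ⟨s', hs1', hs2', hs'⟩ := happ (m + q / M + 2 * δ) δ (by linarith) (by linarith) hδ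
  have hNs : N s = N s' := hN s s' (by linarith) (by linarith) fun l hl h1 h2 =>
    hfree l hl (by linarith) (by linarith)
  have hbound : ∀ x : ℝ, m ≤ x → x ≤ m + 1 →
      K * Real.exp ((d - η) * x) ≤ |K| * (Real.exp (d * m) * Real.exp d * Real.exp (-η * m)) := by
    intro x hx1 hx2
    refine mul_le_mul (le_abs_self K) ?_ (Real.exp_pos _).le (abs_nonneg K)
    rw [← Real.exp_add, ← Real.exp_add]
    refine Real.exp_le_exp.2 ?_
    have h1 : (d : ℝ) * x ≤ d * (m + 1) := by gcongr
    have h2 : η * m ≤ η * x := by gcongr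
    linarith
  have h1 := (abs_le.1 (hs.trans (hbound s (by linarith) (by linarith)))).1
  have h2 := (abs_le.1 (hs'.trans (hbound s' (by linarith) (by linarith)))).1
  have h1' := (abs_le.1 (hs.trans (hbound s (by linarith) (by linarith)))).2
  set X := Real.exp (d * m) * Real.exp d * Real.exp (-η * m) with hX
  have hdiff : Real.exp s' ^ d - Real.exp s ^ d ≤ 2 * (|K| * X) := by linarith
  have hd1 : (1 : ℝ) ≤ d := by exact_mod_cast hd
  have hlow : Real.exp (d * m) * δ ≤ Real.exp s' ^ d - Real.exp s ^ d := by
    rw [← Real.exp_nat_mul, ← Real.exp_nat_mul]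
    have e1 : Real.exp (d * s') = Real.exp (d * s) * Real.exp (d * (s' - s)) := by
      rw [← Real.exp_add]; ring_nf
    have e2 := Real.add_one_le_exp ((d : ℝ) * (s' - s))
    have e3 : δ ≤ d * (s' - s) := by nlinarith
    have e4 : Real.exp (d * m) ≤ Real.exp (d * s) := Real.exp_le_exp.2 (by gcongr; linarith)
    rw [e1]
    calc Real.exp (d * m) * δ ≤ Real.exp (d * s) * (Real.exp (d * (s' - s)) - 1) :=
          mul_le_mul e4 (by linarith) hδ.le (Real.exp_pos _).le
      _ = _ := by ring
  have h3 : δ ≤ 2 * (|K| * (Real.exp d * Real.exp (-η * m))) := by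
    have e := hlow.trans hdiff
    refine le_of_mul_le_mul_left (e.trans_eq ?_) (Real.exp_pos (d * m))
    rw [hX]; ring
  have h4 : 1 ≤ 6 * (|K| * (Real.exp d * Real.exp (-η * m))) * M := by
    have e : δ * (3 * M) = 1 := by rw [hδdef]; field_simp
    have := mul_le_mul_of_nonneg_right h3 (by positivity : 0 ≤ 3 * M)
    linarith
  have h5 : 6 * (|K| * (Real.exp d * Real.exp (-η * m))) * M ≤
      6 * |K| * Real.exp d * B * Real.exp η * (((m : ℝ) + 1) ^ p * Real.exp (-η * (m + 1))) := by
    have e : Real.exp (-η * m) = Real.exp η * Real.exp (-η * (m + 1)) := by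
      rw [← Real.exp_add]; ring_nf
    calc 6 * (|K| * (Real.exp d * Real.exp (-η * m))) * M
        ≤ 6 * (|K| * (Real.exp d * Real.exp (-η * m))) * (B * ((m : ℝ) + 1) ^ p) := by gcongr
      _ = _ := by rw [e]; ring
  linarith

end Multiscale

/-! ### The main theorem -/

open Multiscale in
theorem mainTheorem6 {d n : ℕ} (hd : 0 < d) (σ : Multiscale.SubstitutionScheme d n)
    (hirr : σ.Irreducible) (hinc : σ.Incommensurable) (η : ℝ) (hη : 0 < η)
    (hboundary : ∀ i : Fin n,
      (fun t : ℝ => (volume (Metric.cthickening 1 (frontier (σ.flowSupport t i)))).toReal)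
        =O[atTop] (fun t : ℝ => Real.exp (((d : ℝ) - η) * t)))
    (𝒯 : Set (Multiscale.PlacedTile d n)) (h𝒯 : 𝒯 ∈ σ.tilingSpace) :
    ¬ σ.UniformlySpread 𝒯 := by
  intro hspread
  -- Any type will do; incommensurability provides one.
  obtain ⟨j, -⟩ := id hinc
  obtain ⟨α, -, c, hc, hdisc⟩ := SubstitutionScheme.exists_discrepancy_bound hd hirr hinc
    h𝒯 hspread
  obtain ⟨K₁, hK₁, hthick⟩ := volume_cthickening_le (d := d) c hc.le
  obtain ⟨K₂, hK₂⟩ := (hboundary j).bound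
  obtain ⟨t₀, ht₀⟩ := eventually_atTop.1 hK₂
  obtain ⟨p, B, hJ⟩ := σ.exists_finset_path_lengths
  refine not_exponential_of_few_jumps hd (K := K₁ * K₂) (t₀ := t₀) hη
    (fun s => α ^ d * ((σ.flow s j).ncard : ℝ)) ?_ (p := p) (B := B) ?_
  · intro s δ hs hst hδ
    obtain ⟨s', h1, h2, h3⟩ := hdisc j s δ hs hδ
    refine ⟨s', h1, h2, h3.trans ?_⟩
    have hbd : Bornology.IsBounded (frontier (σ.flowSupport s' j)) := by
      rw [SubstitutionScheme.flowSupport_eq hd]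
      exact (SubstitutionScheme.isBounded_tileSet _).closure.subset frontier_subset_closure
    refine (hthick _ hbd).trans ?_
    rw [mul_assoc]
    refine mul_le_mul_of_nonneg_left ?_ hK₁
    have h4 := ht₀ s' (hst.trans h1)
    rwa [Real.norm_of_nonneg ENNReal.toReal_nonneg, Real.norm_of_nonneg (Real.exp_pos _).le] at h4
  · intro m
    obtain ⟨J, hJ1, hJ2⟩ := hJ m
    refine ⟨J, hJ1, fun s s' hss hs' hfree => ?_⟩
    rw [SubstitutionScheme.ncard_flow_eq hd hss fun k l hl h1 h2 =>
      hfree l (hJ2 _ _ _ hl (by linarith)) h1 h2]
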